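/- **Setting.** Let $\mathcal S,\mathcal A,\mathcal B$ be finite non-empty sets, $\gamma\in[0,1)$, $r:\mathcal S\times\mathcal A\times\mathcal B\to[0,1]$ a reward function and $P:\mathcal S\times\mathcal A\times\mathcal B\to\Delta(\mathcal S)$ a transition kernel (a two-player zero-sum discounted Markov game). Let $0<\tau\le 1/\max\{1,\log|\mathcal A|+\log|\mathcal B|\}$. For policies $\mu:\mathcal S\to\Delta(\mathcal A)$, $\nu:\mathcal S\to\Delta(\mathcal B)$ put $$V_\tau^{\mu,\nu}(s)=\mathbb E\Big[\sum_{t\ge0}\gamma^t\big(r(s_t,a_t,b_t)-\tau\log\mu(a_t|s_t)+\tau\log\nu(b_t|s_t)\big)\,\Big|\,s_0=s\Big],$$ where $a_t\sim\mu(\cdot|s_t)$ and $b_t\sim\nu(\cdot|s_t)$ independently and $s_{t+1}\sim P(\cdot|s_t,a_t,b_t)$, and $V_\tau^{\mu,\nu}(\rho)=\mathbb E_{s\sim\rho}V_\tau^{\mu,\nu}(s)$. Let $\rho\in\Delta(\mathcal S)$ with $\rho(s)>0$ for all $s$. **Coefficients.** Let $$\mathcal C_\rho=\sup_{t\ge0}\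 \sup_{x^{(l)}\in\mathcal A^{\mathcal S},\,y^{(l)}\in\mathcal B^{\mathcal S},\,1\le l\le t}\Big\|\frac{\rho P_{x^{(1)},y^{(1)}}\cdots P_{x^{(t)},y^{(t)}}}{\rho}\Big\|_\infty,\qquad [P_{x,y}]_{s,s'}=P(s'|s,x(s),y(s)),$$ with entrywise division, and $\|1/\rho\|_\infty=\max_s 1/\rho(s)$. With $d_\rho^{\mu,\nu}(s)=(1-\gamma)\,\mathbb E_{s_0\sim\rho}\sum_{t\ge0}\gamma^t\,\mathbb P(s_t=s\,|\,s_0)$, let $$\mathcal C^\dagger_{\rho,\tau}=\max\Big\{\sup_\mu\Big\|\frac{d_\rho^{\mu,\nu_\tau^\dagger(\mu)}}{\rho}\Big\|_\infty,\ \sup_\nu\Big\|\frac{d_\rho^{\mu_\tau^\dagger(\nu),\nu}}{\rho}\Big\|_\infty\Big\},$$ where $\nu_\tau^\dagger(\mu)$ minimizes $\nu\mapsto V_\tau^{\mu,\nu}(\rho)$ and $\mu_\tau^\dagger(\nu)$ maximizes $\mu\mapsto V_\tau^{\mu,\nu}(\rho)$. **Algorithm.** Let $\eta>0$ and let $(\alpha_t)_{t\ge1}$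 be real numbers. Start from uniform policies $\mu^{(0)}=\bar\mu^{(0)}$, $\nu^{(0)}=\bar\nu^{(0)}$ and from $Q^{(0)}=0$, $V^{(0)}=\tau(\log|\mathcal A|-\log|\mathcal B|)$, and for $t\ge0$ and all $s,a,b$ let $$\bar\mu^{(t+1)}(a|s)\propto\mu^{(t)}(a|s)^{1-\eta\tau}e^{\eta[Q^{(t)}(s)\bar\nu^{(t)}(s)]_a},\qquad \bar\nu^{(t+1)}(b|s)\propto\nu^{(t)}(b|s)^{1-\eta\tau}e^{-\eta[Q^{(t)}(s)^\top\bar\mu^{(t)}(s)]_b},$$ $$Q^{(t+1)}(s,a,b)=r(s,a,b)+\gamma\,\mathbb E_{s'\sim P(\cdot|s,a,b)}V^{(t)}(s'),$$ $$V^{(t+1)}(s)=(1-\alpha_{t+1})V^{(t)}(s)+\alpha_{t+1}\big[\bar\mu^{(t+1)}(s)^\top Q^{(t+1)}(s)\bar\nu^{(t+1)}(s)+\tau\mathcal H(\bar\mu^{(t+1)}(s))-\tau\mathcal H(\bar\nu^{(t+1)}(s))\big],$$ $$\mu^{(t+1)}(a|s)\propto\mu^{(t)}(a|s)^{1-\eta\tau}e^{\eta[Q^{(t+1)}(s)\bar\nu^{(t+1)}(s)]_a},\qquad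 \nu^{(t+1)}(b|s)\propto\nu^{(t)}(b|s)^{1-\eta\tau}e^{-\eta[Q^{(t+1)}(s)^\top\bar\mu^{(t+1)}(s)]_b},$$ where $\mathcal H$ is the Shannon entropy. **Theorem 4.** If $0<\eta\le\dfrac{(1-\gamma)^3}{32000\,\mathcal C_\rho}$ and $\alpha_i=\eta\tau$ for all $i\ge1$, then for all $t\ge0$ $$\max_{s\in\mathcal S,\mu,\nu}\Big(V_\tau^{\mu,\bar\nu^{(t)}}(s)-V_\tau^{\bar\mu^{(t)},\nu}(s)\Big)\le\frac{6000\,\|1/\rho\|_\infty}{(1-\gamma)^3\tau}\max\Big\{\frac{8}{(1-\gamma)^2\tau},\frac1\eta\Big\}\Big(1-\frac{(1-\gamma)\eta\tau}{4}\Big)^t$$ and $$\max_{\mu,\nu}\Big(V_\tau^{\mu,\bar\nu^{(t)}}(\rho)-V_\tau^{\bar\mu^{(t)},\nu}(\rho)\Big)\le\frac{6000\,\mathcal C^\dagger_{\rho,\tau}}{(1-\gamma)^3\tau}\max\Big\{\frac{8}{(1-\gamma)^2\tau},\frac1\eta\Big\}\Big(1-\frac{(1-\gamma)\eta\tau}{4}\Big)^t.$$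 -/

import Mathlib

open ProbabilityTheory MeasureTheory

noncomputable section

/-- A two-player zero-sum discounted Markov game with finite state space `S` and finite action
spaces `A` (max player) and `B` (min player); `trans s a b` is the law of the next state. -/
structure MarkovGame (S A B : Type*) [Fintype S] where
  trans : S → A → B → stdSimplex ℝ S
  reward : S → A → B → ℝ
  reward_mem : ∀ s a b, reward s a b ∈ Set.Icc (0 : ℝ) 1
  γ : ℝ
  γ_nonneg : 0 ≤ γ
  γ_lt_one : γ < 1

/-- A stationary Markov policy: a probability vector on the actions `X` for every state. -/
abbrev Policy (S X : Type*) [Fintype X] : Type _ := S → stdSimplex ℝ X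

/-- A probability vector, as a Mathlib probability mass function. -/
def simplexPMF {X : Type*} [Fintype X] (p : stdSimplex ℝ X) : PMF X :=
  PMF.ofFintype (fun x => ENNReal.ofReal (p x)) (by
    have h : ∑ x, ENNReal.ofReal (p x) = ENNReal.ofReal (∑ x, p x) :=
      (ENNReal.ofReal_sum_of_nonneg fun x _ => p.2.1 x).symm
    exact h.trans ((congrArg ENNReal.ofReal p.2.2).trans ENNReal.ofReal_one))

/-- What is observed at one time step of a trajectory: the state and the two actions. -/
structure Step (S A B : Type*) where
  state : S
  maxAct : A
  minAct : B

instance instMeasurableSpaceStep (S A B : Type*) : MeasurableSpace (Step S A B) := ⊤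

/-- Shannon entropy (with `0 log 0 = 0`). -/
def entropy {X : Type*} [Fintype X] (p : stdSimplex ℝ X) : ℝ :=
  -∑ x, p x * Real.log (p x)

namespace MarkovGame

variable {S A B : Type*} [Fintype S] [Fintype A] [Fintype B]

/-! ### Trajectories and value functions -/

/-- Law of `(s, a, b)` with `a ∼ μ(s)` and `b ∼ ν(s)` independent. -/
def actPMF (μ : Policy S A) (ν : Policy S B) (s : S) : PMF (Step S A B) :=
  (simplexPMF (μ s)).bind fun a => (simplexPMF (ν s)).bind fun b => PMF.pure ⟨s, a, b⟩

/-- One step of the trajectory: `s' ∼ P(s, a, b)`, then `a' ∼ μ(s')` and `b' ∼ ν(s')`. -/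
def stepKernel (G : MarkovGame S A B) (μ : Policy S A) (ν : Policy S B) :
    Kernel (Step S A B) (Step S A B) where
  toFun x := ((simplexPMF (G.trans x.state x.maxAct x.minAct)).bind (actPMF μ ν)).toMeasure
  measurable' := measurable_from_top

instance (G : MarkovGame S A B) (μ : Policy S A) (ν : Policy S B) :
    IsMarkovKernel (G.stepKernel μ ν) :=
  ⟨fun x => PMF.toMeasure.isProbabilityMeasure
    ((simplexPMF (G.trans x.state x.maxAct x.minAct)).bind (actPMF μ ν))⟩

/-- Law of the trajectory `(s₀, a₀, b₀), (s₁, a₁, b₁), …` started in `s₀ = s` and generated by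
the policy pair `(μ, ν)`. -/
def pathLaw (G : MarkovGame S A B) (μ : Policy S A) (ν : Policy S B) (s : S) :
    Measure (ℕ → Step S A B) :=
  Kernel.trajMeasure (X := fun _ => Step S A B) (actPMF μ ν s).toMeasure
    (fun n => (G.stepKernel μ ν).comap (fun h => h ⟨n, Finset.mem_Iic.2 le_rfl⟩)
      (measurable_pi_apply _))

/-- The entropy-regularized value function `V_τ^{μ,ν}(s)`. -/
def value (G : MarkovGame S A B) (τ : ℝ) (μ : Policy S A) (ν : Policy S B) (s : S) : ℝ :=
  ∫ ω, ∑' t : ℕ, G.γ ^ t *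
    (G.reward (ω t).state (ω t).maxAct (ω t).minAct
      - τ * Real.log (μ (ω t).state (ω t).maxAct)
      + τ * Real.log (ν (ω t).state (ω t).minAct)) ∂(G.pathLaw μ ν s)

/-- `V_τ^{μ,ν}(ρ)`, the expectation of `V_τ^{μ,ν}(s)` over `s ∼ ρ`. -/
def valueAt (G : MarkovGame S A B) (τ : ℝ) (μ : Policy S A) (ν : Policy S B)
    (ρ : stdSimplex ℝ S) : ℝ :=
  ∑ s, ρ s * G.value τ μ ν s

/-! ### Concentrability and mismatch coefficients -/

/-- State transition matrix `P_{x,y}` of a pair of deterministic policies. -/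
def transMatrix (G : MarkovGame S A B) (x : S → A) (y : S → B) : Matrix S S ℝ :=
  Matrix.of fun s s' => G.trans s (x s) (y s) s'

/-- The row vector `ρ P_{x 0, y 0} ⋯ P_{x (t-1), y (t-1)}`. -/
def pushDist (G : MarkovGame S A B) (ρ : stdSimplex ℝ S) (x : ℕ → S → A) (y : ℕ → S → B) :
    ℕ → S → ℝ
  | 0 => fun s => ρ s
  | t + 1 => Matrix.vecMul (G.pushDist ρ x y t) (G.transMatrix (x t) (y t))

/-- `c_ρ(t)`; the norm is the sup norm over the states. -/
def concentrabilityAt (G : MarkovGame S A B) (ρ : stdSimplex ℝ S) (t : ℕ) : ℝ :=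
  ⨆ xy : (ℕ → S → A) × (ℕ → S → B), ‖fun s => G.pushDist ρ xy.1 xy.2 t s / ρ s‖

/-- The concentrability coefficient `C_ρ = sup_t c_ρ(t)`. -/
def concentrability (G : MarkovGame S A B) (ρ : stdSimplex ℝ S) : ℝ :=
  ⨆ t : ℕ, G.concentrabilityAt ρ t

/-- The discounted state visitation distribution `d_ρ^{μ,ν}`. -/
def visitation (G : MarkovGame S A B) (ρ : stdSimplex ℝ S) (μ : Policy S A) (ν : Policy S B)
    (s : S) : ℝ :=
  (1 - G.γ) * ∑ s₀, ρ s₀ * ∑' t : ℕ, G.γ ^ t * (G.pathLaw μ ν s₀).real {ω | (ω t).state = s}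

/-- `ν` minimizes `V_τ^{μ,·}(ρ)`, i.e. `ν = ν_τ^†(μ)`. -/
def IsMinResponse (G : MarkovGame S A B) (τ : ℝ) (ρ : stdSimplex ℝ S) (μ : Policy S A)
    (ν : Policy S B) : Prop :=
  ∀ ν' : Policy S B, G.valueAt τ μ ν ρ ≤ G.valueAt τ μ ν' ρ

/-- `μ` maximizes `V_τ^{·,ν}(ρ)`, i.e. `μ = μ_τ^†(ν)`. -/
def IsMaxResponse (G : MarkovGame S A B) (τ : ℝ) (ρ : stdSimplex ℝ S) (μ : Policy S A)
    (ν : Policy S B) : Prop :=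
  ∀ μ' : Policy S A, G.valueAt τ μ' ν ρ ≤ G.valueAt τ μ ν ρ

/-- The regularized minimax mismatch coefficient `C_{ρ,τ}^†`. -/
def mismatch (G : MarkovGame S A B) (τ : ℝ) (ρ : stdSimplex ℝ S) : ℝ :=
  max
    (sSup {c : ℝ | ∃ (μ : Policy S A) (ν : Policy S B), G.IsMinResponse τ ρ μ ν ∧
      c = ‖fun s => G.visitation ρ μ ν s / ρ s‖})
    (sSup {c : ℝ | ∃ (μ : Policy S A) (ν : Policy S B), G.IsMaxResponse τ ρ μ ν ∧
      c = ‖fun s => G.visitation ρ μ ν s / ρ s‖})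

end MarkovGame

/-! ### Entropy-regularized optimistic multiplicative weights -/

/-- The probability vector `∝ p(x)^{1-ητ} exp(η g(x))`. -/
def expUpdate {X : Type*} [Fintype X] (η τ : ℝ) (p : stdSimplex ℝ X) (g : X → ℝ) :
    stdSimplex ℝ X :=
  ⟨fun x => p x ^ (1 - η * τ) * Real.exp (η * g x) /
      ∑ z, p z ^ (1 - η * τ) * Real.exp (η * g z), by
    have h0 : ∀ x, 0 ≤ p x ^ (1 - η * τ) * Real.exp (η * g x) := fun x =>
      mul_nonneg (Real.rpow_nonneg (p.2.1 x) _) (Real.exp_pos _).le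
    have h1 : 0 < ∑ z, p z ^ (1 - η * τ) * Real.exp (η * g z) := by
      obtain ⟨x, hx⟩ : ∃ x, 0 < p x := by
        by_contra h
        push Not at h
        have h2 : ∑ x, p x = 1 := p.2.2
        linarith [Finset.sum_nonpos (s := Finset.univ) fun x _ => h x]
      exact Finset.sum_pos' (fun z _ => h0 z)
        ⟨x, Finset.mem_univ x, mul_pos (Real.rpow_pos_of_pos hx _) (Real.exp_pos _)⟩
    refine ⟨fun x => div_nonneg (h0 x) h1.le, ?_⟩
    rw [← Finset.sum_div, div_self h1.ne']⟩

/-- The iterates of the algorithm at one time: `μ^(t), ν^(t), μ̄^(t), ν̄^(t), Q^(t), V^(t)`. -/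
structure Iterate (S A B : Type*) [Fintype A] [Fintype B] where
  μ : Policy S A
  ν : Policy S B
  μbar : Policy S A
  νbar : Policy S B
  Q : S → A → B → ℝ
  V : S → ℝ

namespace Iterate

variable {S A B : Type*} [Fintype A] [Fintype B]

/-- `f_s(Q, μ̄, ν̄) = μ̄(s)ᵀ Q(s) ν̄(s) + τ H(μ̄(s)) - τ H(ν̄(s))`. -/
def stageValue (τ : ℝ) (Q : S → A → B → ℝ) (μ : Policy S A) (ν : Policy S B) (s : S) : ℝ :=
  (∑ a, ∑ b, μ s a * Q s a b * ν s b) + τ * entropy (μ s) - τ * entropy (ν s)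

/-- `(μ(s), ν(s)) ↦ μ'(s) ∝ μ(s)^{1-ητ} exp(η Q(s) ν̄(s))`. -/
def maxUpdate (η τ : ℝ) (Q : S → A → B → ℝ) (μ : Policy S A) (νbar : Policy S B) :
    Policy S A :=
  fun s => expUpdate η τ (μ s) fun a => ∑ b, Q s a b * νbar s b

/-- `ν'(s) ∝ ν(s)^{1-ητ} exp(-η Q(s)ᵀ μ̄(s))`. -/
def minUpdate (η τ : ℝ) (Q : S → A → B → ℝ) (ν : Policy S B) (μbar : Policy S A) :
    Policy S B :=
  fun s => expUpdate η τ (ν s) fun b => -∑ a, Q s a b * μbar s a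

/-- Initialization: uniform policies, `Q^(0) = 0`, `V^(0) = τ (log |A| - log |B|)`. -/
def init (S A B : Type*) [Fintype A] [Fintype B] [Nonempty A] [Nonempty B] (τ : ℝ) :
    Iterate S A B where
  μ := fun _ => stdSimplex.barycenter
  ν := fun _ => stdSimplex.barycenter
  μbar := fun _ => stdSimplex.barycenter
  νbar := fun _ => stdSimplex.barycenter
  Q := fun _ _ _ => 0
  V := fun _ => τ * (Real.log (Fintype.card A) - Real.log (Fintype.card B))

/-- From the iterates at time `t` to those at time `t + 1`, with `α = α_{t+1}`: first the
predictions `μ̄^(t+1), ν̄^(t+1)`, then `Q^(t+1), V^(t+1)`, then `μ^(t+1), ν^(t+1)`. -/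
def next [Fintype S] (G : MarkovGame S A B) (η τ α : ℝ) (z : Iterate S A B) :
    Iterate S A B :=
  let μbar' := maxUpdate η τ z.Q z.μ z.νbar
  let νbar' := minUpdate η τ z.Q z.ν z.μbar
  let Q' : S → A → B → ℝ := fun s a b =>
    G.reward s a b + G.γ * ∑ s', G.trans s a b s' * z.V s'
  { μ := maxUpdate η τ Q' z.μ νbar'
    ν := minUpdate η τ Q' z.ν μbar'
    μbar := μbar'
    νbar := νbar'
    Q := Q'
    V := fun s => (1 - α) * z.V s + α * stageValue τ Q' μbar' νbar' s }

/-- The algorithm with policy learning rate `η` and value learning rates `α 1, α 2, …`. -/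
def run [Fintype S] [Nonempty A] [Nonempty B] (G : MarkovGame S A B) (η τ : ℝ) (α : ℕ → ℝ) :
    ℕ → Iterate S A B
  | 0 => init S A B τ
  | t + 1 => next G η τ (α (t + 1)) (run G η τ α t)

end Iterate

end

/-! Compare everything with a regularized Nash equilibrium. Its value `W` is the fixed point of the
discounted stage operator, a contraction because the value of a matrix game is nonexpansive in the
matrix; the stage equilibria themselves come from Sion's theorem (`exists_isEquilibrium`,
`exists_equilibrium`).

Reduction of the gap. The performance difference identity `value_sub_eq` writes a value minus `W` as
a visitation average of stage residuals, so the duality gap is an average of stage gaps. In a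
regularized matrix game a deviation from a soft best response costs exactly `τ` times a relative
entropy, so stage gaps are controlled by relative entropies between equilibrium, iterate and
prediction (`IsEquilibrium.gameValue_sub_le`). Visitation weights are traded for `ρ` at the price of
`‖1/ρ‖`, or of the mismatch coefficient when the opponents are best responses. It remains to show
that the `ρ`-averaged relative entropies decay geometrically.

Decay. The mirror descent identity `expUpdate_regret`, summed over the players, contracts the
divergence to equilibrium by `1 - η τ`, up to errors of the matrices `Q` and of the predictions.
Optimism makes the prediction error of second order, small enough for the negative divergence terms
to absorb it (`relEntropy_bar_le`, `relEntropy_step_le`). The value learning rate `η τ` is also the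
contraction rate of the relative entropy, so value error and `τ` times divergence combine into one
potential `vErr`, contracted by the same factor (`vErr_succ_le`), while the next `Q` error is at
most `γ` times it (`qErr_succ_le`).

The value errors are measured by `reachSup`, the largest mean over distributions reachable from `ρ`:
a maximum over actions turns into one more deterministic transition, which stays in this class. Only
the divergence terms must be brought back to `ρ`; this costs the concentrability coefficient and is
why `η` is small compared with its inverse. The weighted sum `lyapunov` then shrinks by `1 - (1 - γ)
η τ / 4` per step (`lyapunov_step_le`). -/

set_option linter.unusedSectionVars false

noncomputable section

/-! ### Relative entropy of finite probability vectors -/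

section RelativeEntropy

variable {X : Type*} [Fintype X]

/-- Relative entropy of two probability vectors. -/
def relEntropy (p q : stdSimplex ℝ X) : ℝ := ∑ x, p x * (Real.log (p x) - Real.log (q x))

/-- The `ℓ¹` distance of two probability vectors. -/
def l1Dist (p q : stdSimplex ℝ X) : ℝ := ∑ x, |p x - q x|

lemma l1Dist_nonneg (p q : stdSimplex ℝ X) : 0 ≤ l1Dist p q :=
  Finset.sum_nonneg fun _ _ => abs_nonneg _

lemma l1Dist_comm (p q : stdSimplex ℝ X) : l1Dist p q = l1Dist q p :=
  Finset.sum_congr rfl fun _ _ => abs_sub_comm _ _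

lemma l1Dist_triangle (p q r : stdSimplex ℝ X) : l1Dist p r ≤ l1Dist p q + l1Dist q r := by
  unfold l1Dist
  rw [← Finset.sum_add_distrib]
  exact Finset.sum_le_sum fun _ _ => abs_sub_le _ _ _

lemma relEntropy_self (p : stdSimplex ℝ X) : relEntropy p p = 0 := by simp [relEntropy]

/-- Pointwise comparison of relative entropy and squared Hellinger distance. -/
lemma sq_sqrt_sub_sqrt_le {x y : ℝ} (hx : 0 ≤ x) (hy : 0 < y) :
    (√x - √y) ^ 2 ≤ x * (Real.log x - Real.log y) - x + y := by
  rcases hx.eq_or_lt with rfl | hx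
  · simp [Real.sq_sqrt hy.le]
  -- The inequality `log u ≤ u - 1` at `u = √y / √x`, to be multiplied by `2 x`.
  have h := Real.log_le_sub_one_of_pos (div_pos (Real.sqrt_pos.2 hy) (Real.sqrt_pos.2 hx))
  rw [Real.log_div (Real.sqrt_pos.2 hy).ne' (Real.sqrt_pos.2 hx).ne', Real.log_sqrt hy.le,
    Real.log_sqrt hx.le] at h
  have hsx := Real.sq_sqrt hx.le
  have hsy := Real.sq_sqrt hy.le
  have h3 : x * (√y / √x) = √x * √y := by
    have := Real.sqrt_pos.2 hx
    field_simp
    rw [hsx]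
  nlinarith [mul_le_mul_of_nonneg_left h hx.le]

/-- In the sum of the pointwise bounds the linear terms cancel, both vectors having mass one. This
gives nonnegativity and Pinsker's inequality together. -/
lemma sum_sq_sqrt_sub_le_relEntropy (p q : stdSimplex ℝ X) (hq : ∀ x, 0 < q x) :
    ∑ x, (√(p x) - √(q x)) ^ 2 ≤ relEntropy p q := by
  calc _ ≤ ∑ x, (p x * (Real.log (p x) - Real.log (q x)) - p x + q x) :=
        Finset.sum_le_sum fun x _ => sq_sqrt_sub_sqrt_le (p.2.1 x) (hq x)
    _ = relEntropy p q := by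
        rw [Finset.sum_add_distrib, Finset.sum_sub_distrib, stdSimplex.sum_eq_one,
          stdSimplex.sum_eq_one, relEntropy]
        ring

lemma relEntropy_nonneg (p q : stdSimplex ℝ X) (hq : ∀ x, 0 < q x) : 0 ≤ relEntropy p q :=
  (Finset.sum_nonneg fun _ _ => sq_nonneg _).trans (sum_sq_sqrt_sub_le_relEntropy p q hq)

/-- A form of Pinsker's inequality. -/
lemma sq_l1Dist_le (p q : stdSimplex ℝ X) (hq : ∀ x, 0 < q x) :
    l1Dist p q ^ 2 ≤ 4 * relEntropy p q := by
  -- Cauchy–Schwarz on `p - q = (√p - √q)(√p + √q)`; the second factor has squared norm at most `4`.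
  have h1 : l1Dist p q = ∑ x, |√(p x) - √(q x)| * (√(p x) + √(q x)) := by
    refine Finset.sum_congr rfl fun x _ => ?_
    have h2 : p x - q x = (√(p x) - √(q x)) * (√(p x) + √(q x)) := by
      have h3 : √(p x) ^ 2 = p x := Real.sq_sqrt (p.2.1 x)
      have h4 : √(q x) ^ 2 = q x := Real.sq_sqrt (q.2.1 x)
      linear_combination h4 - h3
    rw [h2, abs_mul, abs_of_nonneg (add_nonneg (Real.sqrt_nonneg (p x)) (Real.sqrt_nonneg _))]
  have h2 : ∑ x, (√(p x) + √(q x)) ^ 2 ≤ 4 := by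
    calc _ ≤ ∑ x, (2 * p x + 2 * q x) := by
          refine Finset.sum_le_sum fun x _ => ?_
          have h3 : √(p x) ^ 2 = p x := Real.sq_sqrt (p.2.1 x)
          have h4 : √(q x) ^ 2 = q x := Real.sq_sqrt (q.2.1 x)
          nlinarith [sq_nonneg (√(p x) - √(q x))]
      _ = 4 := by
          rw [Finset.sum_add_distrib, ← Finset.mul_sum, ← Finset.mul_sum, stdSimplex.sum_eq_one,
            stdSimplex.sum_eq_one]
          norm_num
  rw [h1]
  refine (Finset.sum_mul_sq_le_sq_mul_sq _ _ _).trans ?_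
  simp only [sq_abs]
  have h3 := sum_sq_sqrt_sub_le_relEntropy p q hq
  have h4 : 0 ≤ ∑ x, (√(p x) - √(q x)) ^ 2 := Finset.sum_nonneg fun _ _ => sq_nonneg _
  nlinarith

lemma eq_of_relEntropy_nonpos (p q : stdSimplex ℝ X) (hq : ∀ x, 0 < q x)
    (h : relEntropy p q ≤ 0) : p = q := by
  have h1 : l1Dist p q = 0 := by
    have := sq_l1Dist_le p q hq
    exact pow_eq_zero_iff (two_ne_zero) |>.1 (le_antisymm (by linarith) (sq_nonneg _))
  refine stdSimplex.ext (funext fun x => ?_)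
  have h2 := (Finset.sum_eq_zero_iff_of_nonneg fun x _ => abs_nonneg _).1 h1 x (Finset.mem_univ x)
  exact sub_eq_zero.1 (abs_eq_zero.1 h2)

/-- Normalizing constants enter the logarithms of exponential updates additively; this is what makes
them disappear. -/
lemma sum_mul_sub_const (p q : stdSimplex ℝ X) (c : ℝ) : ∑ x, (p x - q x) * c = 0 := by
  rw [← Finset.sum_mul, Finset.sum_sub_distrib, stdSimplex.sum_eq_one, stdSimplex.sum_eq_one]
  simp

lemma sum_sub_mul_le (p q : stdSimplex ℝ X) (δ : X → ℝ) (D : ℝ) (hδ : ∀ x, |δ x| ≤ D) :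
    ∑ x, (p x - q x) * δ x ≤ l1Dist p q * D := by
  rw [l1Dist, Finset.sum_mul]
  refine Finset.sum_le_sum fun x _ => (le_abs_self _).trans ?_
  rw [abs_mul]
  exact mul_le_mul_of_nonneg_left (hδ x) (abs_nonneg _)

/-- Symmetrized relative entropy of two vectors with prescribed log-ratio. -/
lemma relEntropy_add_relEntropy (p q : stdSimplex ℝ X) (δ : X → ℝ) (c : ℝ)
    (h : ∀ x, Real.log (p x) - Real.log (q x) = δ x + c) :
    relEntropy p q + relEntropy q p = ∑ x, (p x - q x) * δ x := by
  have h1 : relEntropy p q + relEntropy q p = ∑ x, (p x - q x) * δ x + ∑ x, (p x - q x) * c := by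
    rw [relEntropy, relEntropy, ← Finset.sum_add_distrib, ← Finset.sum_add_distrib]
    refine Finset.sum_congr rfl fun x _ => ?_
    linear_combination (p x - q x) * h x
  rw [h1, sum_mul_sub_const, add_zero]

/-- Stability of probability vectors under perturbation of their logarithms. -/
lemma l1Dist_le_of_log_sub (p q : stdSimplex ℝ X) (hp : ∀ x, 0 < p x) (hq : ∀ x, 0 < q x)
    (δ : X → ℝ) (c D : ℝ) (hD : 0 ≤ D) (h : ∀ x, Real.log (p x) - Real.log (q x) = δ x + c)
    (hδ : ∀ x, |δ x| ≤ D) : l1Dist p q ≤ 2 * D := by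
  have h1 := relEntropy_add_relEntropy p q δ c h
  have h2 := sum_sub_mul_le p q δ D hδ
  have h3 := sq_l1Dist_le p q hq
  have h4 := sq_l1Dist_le q p hp
  rw [l1Dist_comm] at h4
  have h5 := l1Dist_nonneg p q
  -- Pinsker in both directions gives `l1Dist² ≤ 2 (l1Dist * D)`; one factor cancels.
  by_contra! h6
  nlinarith

/-- The symmetrized divergence is at most `l1Dist * D`, and the distance is itself at most `2 D`:
the divergence is quadratic in the perturbation. -/
lemma relEntropy_le_of_log_sub (p q : stdSimplex ℝ X) (hp : ∀ x, 0 < p x) (hq : ∀ x, 0 < q x)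
    (δ : X → ℝ) (c D : ℝ) (hD : 0 ≤ D) (h : ∀ x, Real.log (p x) - Real.log (q x) = δ x + c)
    (hδ : ∀ x, |δ x| ≤ D) : relEntropy p q ≤ 2 * D ^ 2 := by
  have h1 := relEntropy_add_relEntropy p q δ c h
  have h2 := sum_sub_mul_le p q δ D hδ
  have h3 := l1Dist_le_of_log_sub p q hp hq δ c D hD h hδ
  have h4 := relEntropy_nonneg q p hp
  nlinarith

lemma entropy_nonneg (p : stdSimplex ℝ X) : 0 ≤ entropy p := by
  rw [entropy, ← Finset.sum_neg_distrib]
  refine Finset.sum_nonneg fun x _ => ?_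
  have := Real.negMulLog_nonneg (p.2.1 x) (stdSimplex.le_one p x)
  rw [Real.negMulLog] at this
  change 0 ≤ -p x * Real.log (p x) at this
  linarith

lemma barycenter_pos [Nonempty X] (x : X) : 0 < (stdSimplex.barycenter : stdSimplex ℝ X) x := by
  change (0 : ℝ) < (Fintype.card X : ℝ)⁻¹
  positivity

lemma log_barycenter [Nonempty X] (x : X) :
    Real.log ((stdSimplex.barycenter : stdSimplex ℝ X) x) = -Real.log (Fintype.card X) := by
  change Real.log ((Fintype.card X : ℝ)⁻¹) = _
  rw [Real.log_inv]

lemma relEntropy_barycenter [Nonempty X] (p : stdSimplex ℝ X) :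
    relEntropy p stdSimplex.barycenter = Real.log (Fintype.card X) - entropy p := by
  have h1 : ∑ x, p x * Real.log (Fintype.card X) = Real.log (Fintype.card X) := by
    rw [← Finset.sum_mul, stdSimplex.sum_eq_one, one_mul]
  rw [relEntropy, entropy, sub_neg_eq_add]
  nth_rewrite 1 [← h1]
  rw [← Finset.sum_add_distrib]
  refine Finset.sum_congr rfl fun x _ => ?_
  rw [log_barycenter]
  ring

lemma entropy_le_log_card [Nonempty X] (p : stdSimplex ℝ X) :
    entropy p ≤ Real.log (Fintype.card X) := by
  have := relEntropy_nonneg p stdSimplex.barycenter barycenter_pos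
  rw [relEntropy_barycenter] at this
  linarith

lemma relEntropy_barycenter_le [Nonempty X] (p : stdSimplex ℝ X) :
    relEntropy p stdSimplex.barycenter ≤ Real.log (Fintype.card X) := by
  rw [relEntropy_barycenter]
  linarith [entropy_nonneg p]

lemma entropy_barycenter [Nonempty X] :
    entropy (stdSimplex.barycenter : stdSimplex ℝ X) = Real.log (Fintype.card X) := by
  have := relEntropy_barycenter (stdSimplex.barycenter : stdSimplex ℝ X)
  rw [relEntropy_self] at this
  linarith

/-! ### Exponential updates -/

lemma exists_pos (p : stdSimplex ℝ X) : ∃ x, 0 < p x := by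
  by_contra! h
  have h2 : ∑ x, p x = 1 := p.2.2
  linarith [Finset.sum_nonpos (s := Finset.univ) fun x _ => h x]

lemma expUpdate_apply (η τ : ℝ) (p : stdSimplex ℝ X) (g : X → ℝ) (x : X) :
    expUpdate η τ p g x = p x ^ (1 - η * τ) * Real.exp (η * g x) /
      ∑ z, p z ^ (1 - η * τ) * Real.exp (η * g z) := rfl

lemma expUpdate_denom_pos (η τ : ℝ) (p : stdSimplex ℝ X) (hp : ∀ x, 0 < p x) (g : X → ℝ) :
    0 < ∑ z, p z ^ (1 - η * τ) * Real.exp (η * g z) := by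
  obtain ⟨x, -⟩ := exists_pos p
  exact Finset.sum_pos (fun z _ => mul_pos (Real.rpow_pos_of_pos (hp z) _) (Real.exp_pos _))
    ⟨x, Finset.mem_univ x⟩

lemma expUpdate_pos (η τ : ℝ) (p : stdSimplex ℝ X) (hp : ∀ x, 0 < p x) (g : X → ℝ) (x : X) :
    0 < expUpdate η τ p g x := by
  rw [expUpdate_apply]
  exact div_pos (mul_pos (Real.rpow_pos_of_pos (hp x) _) (Real.exp_pos _))
    (expUpdate_denom_pos η τ p hp g)

lemma log_expUpdate (η τ : ℝ) (p : stdSimplex ℝ X) (hp : ∀ x, 0 < p x) (g : X → ℝ) (x : X) :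
    Real.log (expUpdate η τ p g x) = (1 - η * τ) * Real.log (p x) + η * g x -
      Real.log (∑ z, p z ^ (1 - η * τ) * Real.exp (η * g z)) := by
  rw [expUpdate_apply, Real.log_div (mul_pos (Real.rpow_pos_of_pos (hp x) _) (Real.exp_pos _)).ne'
    (expUpdate_denom_pos η τ p hp g).ne', Real.log_mul (Real.rpow_pos_of_pos (hp x) _).ne'
    (Real.exp_pos _).ne', Real.log_rpow (hp x), Real.log_exp]

/-- The mirror descent identity for the exponential update. -/
lemma expUpdate_regret (η τ : ℝ) (p : stdSimplex ℝ X) (hp : ∀ x, 0 < p x) (g : X → ℝ)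
    (q m : stdSimplex ℝ X) :
    η * (∑ x, q x * g x - ∑ x, m x * g x) + η * τ * (entropy q - entropy m) =
      (1 - η * τ) * relEntropy q p - relEntropy q (expUpdate η τ p g)
        + relEntropy m (expUpdate η τ p g) - (1 - η * τ) * relEntropy m p := by
  -- The log-normalizer pairs to zero with `q - m`; once this zero is inserted the identity holds
  -- term by term.
  have h := sum_mul_sub_const q m (Real.log (∑ z, p z ^ (1 - η * τ) * Real.exp (η * g z)))
  rw [← sub_eq_zero, ← h]
  simp only [entropy, relEntropy, ← Finset.sum_neg_distrib, Finset.mul_sum,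
    ← Finset.sum_sub_distrib, ← Finset.sum_add_distrib]
  refine Finset.sum_congr rfl fun x _ => ?_
  rw [log_expUpdate η τ p hp g x]
  ring

/-- Two exponential updates of the same vector with nearby exponents. -/
lemma l1Dist_expUpdate_le (η τ : ℝ) (hη : 0 ≤ η) (p : stdSimplex ℝ X) (hp : ∀ x, 0 < p x)
    (g g' : X → ℝ) (D : ℝ) (hD : 0 ≤ D) (h : ∀ x, |g x - g' x| ≤ D) :
    l1Dist (expUpdate η τ p g) (expUpdate η τ p g') ≤ 2 * (η * D) := by
  refine l1Dist_le_of_log_sub _ _ (expUpdate_pos η τ p hp g) (expUpdate_pos η τ p hp g')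
    (fun x => η * (g x - g' x)) (Real.log (∑ z, p z ^ (1 - η * τ) * Real.exp (η * g' z)) -
      Real.log (∑ z, p z ^ (1 - η * τ) * Real.exp (η * g z))) _ (mul_nonneg hη hD)
    (fun x => ?_) (fun x => ?_)
  · rw [log_expUpdate η τ p hp, log_expUpdate η τ p hp]
    ring
  · rw [abs_mul, abs_of_nonneg hη]
    exact mul_le_mul_of_nonneg_left (h x) hη

/-- Both updates have the same prior, so their log-ratio is `η (g - g')` up to a constant. The
reverse divergence is kept: it later absorbs errors. -/
lemma relEntropy_expUpdate_le (η τ : ℝ) (hη : 0 ≤ η) (p : stdSimplex ℝ X) (hp : ∀ x, 0 < p x)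
    (g g' : X → ℝ) (D : ℝ) (h : ∀ x, |g x - g' x| ≤ D) :
    relEntropy (expUpdate η τ p g) (expUpdate η τ p g') ≤
      η * (l1Dist (expUpdate η τ p g) (expUpdate η τ p g') * D)
        - relEntropy (expUpdate η τ p g') (expUpdate η τ p g) := by
  have h1 := relEntropy_add_relEntropy (expUpdate η τ p g) (expUpdate η τ p g')
    (fun x => η * (g x - g' x)) (Real.log (∑ z, p z ^ (1 - η * τ) * Real.exp (η * g' z)) -
      Real.log (∑ z, p z ^ (1 - η * τ) * Real.exp (η * g z))) (fun x => by
        rw [log_expUpdate η τ p hp, log_expUpdate η τ p hp]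
        ring)
  have h2 := sum_sub_mul_le (expUpdate η τ p g) (expUpdate η τ p g')
    (fun x => η * (g x - g' x)) (η * D) (fun x => by
      rw [abs_mul, abs_of_nonneg hη]
      exact mul_le_mul_of_nonneg_left (h x) hη)
  linarith

/-- The probability vector `∝ exp(w)`. -/
def gibbs [Nonempty X] (w : X → ℝ) : stdSimplex ℝ X :=
  -- With `η = τ = 1` the exponent `1 - η τ` vanishes, so the prior plays no role beyond being
  -- positive.
  expUpdate 1 1 stdSimplex.barycenter w

lemma gibbs_pos [Nonempty X] (w : X → ℝ) (x : X) : 0 < gibbs w x :=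
  expUpdate_pos 1 1 _ barycenter_pos w x

lemma log_gibbs [Nonempty X] (w : X → ℝ) :
    ∃ c, ∀ x, Real.log (gibbs w x) = w x - c := by
  refine ⟨Real.log (∑ z, (stdSimplex.barycenter : stdSimplex ℝ X) z ^ ((1 : ℝ) - 1 * 1) *
    Real.exp (1 * w z)), fun x => ?_⟩
  rw [gibbs, log_expUpdate 1 1 _ barycenter_pos]
  simp

/-- The Gibbs variational principle. -/
lemma gibbs_variational [Nonempty X] (w : X → ℝ) (p : stdSimplex ℝ X) :
    (∑ x, gibbs w x * w x + entropy (gibbs w)) - (∑ x, p x * w x + entropy p) =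
      relEntropy p (gibbs w) := by
  -- The prior terms carry the factor `1 - 1 * 1 = 0`, so the mirror descent identity is the
  -- variational principle.
  have h := expUpdate_regret 1 1 stdSimplex.barycenter barycenter_pos w (gibbs w) p
  rw [← gibbs, relEntropy_self] at h
  linarith

end RelativeEntropy

/-! ### Entropy-regularized matrix games -/

section MatrixGame

variable {A B : Type*} [Fintype A] [Fintype B]

/-- Payoff of the entropy-regularized matrix game with matrix `M`. -/
def gameValue (τ : ℝ) (M : A → B → ℝ) (p : stdSimplex ℝ A) (q : stdSimplex ℝ B) : ℝ :=
  (∑ a, ∑ b, p a * M a b * q b) + τ * entropy p - τ * entropy q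

lemma gameValue_eq (τ : ℝ) (M : A → B → ℝ) (p : stdSimplex ℝ A) (q : stdSimplex ℝ B) :
    gameValue τ M p q = (∑ a, p a * ∑ b, M a b * q b) + τ * entropy p - τ * entropy q := by
  simp only [gameValue, Finset.mul_sum, mul_assoc]

/-- Negating and transposing the matrix exchanges the players, so estimates for the max player
transfer to the min player. -/
lemma gameValue_swap (τ : ℝ) (M : A → B → ℝ) (p : stdSimplex ℝ A) (q : stdSimplex ℝ B) :
    gameValue τ (fun b a => -M a b) q p = -gameValue τ M p q := by
  have h : ∑ b, ∑ a, q b * -M a b * p a = -∑ a, ∑ b, p a * M a b * q b := by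
    rw [Finset.sum_comm]
    simp only [← Finset.sum_neg_distrib]
    exact Finset.sum_congr rfl fun a _ => Finset.sum_congr rfl fun b _ => by ring
  rw [gameValue, gameValue, h]
  ring

lemma abs_sum_mul_simplex_le (q : stdSimplex ℝ B) (f : B → ℝ) (c : ℝ) (h : ∀ b, |f b| ≤ c) :
    |∑ b, f b * q b| ≤ c := by
  calc |∑ b, f b * q b| ≤ ∑ b, |f b * q b| := Finset.abs_sum_le_sum_abs _ _
    _ ≤ ∑ b, c * q b := Finset.sum_le_sum fun b _ => by
        rw [abs_mul, abs_of_nonneg (stdSimplex.zero_le q b)]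
        exact mul_le_mul_of_nonneg_right (h b) (q.2.1 b)
    _ = c := by rw [← Finset.mul_sum, stdSimplex.sum_eq_one, mul_one]

lemma abs_sum_mul_sub_le (q q' : stdSimplex ℝ B) (f : B → ℝ) (c : ℝ) (h : ∀ b, |f b| ≤ c) :
    |∑ b, f b * q b - ∑ b, f b * q' b| ≤ c * l1Dist q q' := by
  rw [← Finset.sum_sub_distrib, l1Dist, Finset.mul_sum]
  refine (Finset.abs_sum_le_sum_abs _ _).trans (Finset.sum_le_sum fun b _ => ?_)
  rw [← mul_sub, abs_mul]
  exact mul_le_mul_of_nonneg_right (h b) (abs_nonneg _)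

lemma abs_gameValue_sub_le (τ : ℝ) (M M' : A → B → ℝ) (p : stdSimplex ℝ A) (q : stdSimplex ℝ B)
    (d : ℝ) (h : ∀ a b, |M a b - M' a b| ≤ d) :
    |gameValue τ M p q - gameValue τ M' p q| ≤ d := by
  have h1 : gameValue τ M p q - gameValue τ M' p q =
      ∑ a, (∑ b, (M a b - M' a b) * q b) * p a := by
    rw [gameValue_eq, gameValue_eq, show ∀ x y z w : ℝ, x + y - z - (w + y - z) = x - w by
      intros; ring, ← Finset.sum_sub_distrib]
    refine Finset.sum_congr rfl fun a _ => ?_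
    simp only [sub_mul, Finset.sum_sub_distrib]
    ring
  rw [h1]
  exact abs_sum_mul_simplex_le p _ d fun a => abs_sum_mul_simplex_le q _ d fun b => h a b

lemma abs_gameValue_le [Nonempty A] [Nonempty B] (τ : ℝ) (hτ : 0 ≤ τ) (M : A → B → ℝ)
    (p : stdSimplex ℝ A) (q : stdSimplex ℝ B) (d : ℝ) (h : ∀ a b, |M a b| ≤ d) :
    |gameValue τ M p q| ≤
      d + τ * (Real.log (Fintype.card A) + Real.log (Fintype.card B)) := by
  have h1 : |∑ a, p a * ∑ b, M a b * q b| ≤ d := by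
    simp_rw [mul_comm (p _)]
    exact abs_sum_mul_simplex_le p _ d fun a => abs_sum_mul_simplex_le q _ d fun b => h a b
  rw [gameValue_eq]
  have h2 := mul_le_mul_of_nonneg_left (entropy_le_log_card p) hτ
  have h3 := mul_le_mul_of_nonneg_left (entropy_le_log_card q) hτ
  have h4 := mul_nonneg hτ (entropy_nonneg p)
  have h5 := mul_nonneg hτ (entropy_nonneg q)
  rw [abs_le] at h1 ⊢
  constructor <;> linarith [h1.1, h1.2]

/-- The smoothed best response of the max player. -/
def softResponse [Nonempty A] (τ : ℝ) (M : A → B → ℝ) (q : stdSimplex ℝ B) : stdSimplex ℝ A :=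
  gibbs fun a => (∑ b, M a b * q b) / τ

lemma softResponse_pos [Nonempty A] (τ : ℝ) (M : A → B → ℝ) (q : stdSimplex ℝ B) (a : A) :
    0 < softResponse τ M q a := gibbs_pos _ a

/-- The Gibbs variational principle scaled by `τ`; the opponent's entropy cancels. The equality is
used in both directions. -/
lemma gameValue_softResponse_sub [Nonempty A] {τ : ℝ} (hτ : 0 < τ) (M : A → B → ℝ)
    (p : stdSimplex ℝ A) (q : stdSimplex ℝ B) :
    gameValue τ M (softResponse τ M q) q - gameValue τ M p q =
      τ * relEntropy p (softResponse τ M q) := by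
  have h := gibbs_variational (fun a => (∑ b, M a b * q b) / τ) p
  rw [← softResponse] at h
  have h1 : ∀ p : stdSimplex ℝ A, ∑ a, p a * ∑ b, M a b * q b =
      τ * ∑ a, p a * ((∑ b, M a b * q b) / τ) := fun p => by
    rw [Finset.mul_sum]
    exact Finset.sum_congr rfl fun a _ => by field_simp
  rw [gameValue_eq, gameValue_eq, h1, h1, ← h]
  ring

lemma gameValue_le_softResponse [Nonempty A] {τ : ℝ} (hτ : 0 < τ) (M : A → B → ℝ)
    (p : stdSimplex ℝ A) (q : stdSimplex ℝ B) :
    gameValue τ M p q ≤ gameValue τ M (softResponse τ M q) q := by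
  have h := gameValue_softResponse_sub hτ M p q
  have := mul_nonneg hτ.le (relEntropy_nonneg p _ (softResponse_pos τ M q))
  linarith

lemma eq_softResponse [Nonempty A] {τ : ℝ} (hτ : 0 < τ) (M : A → B → ℝ)
    (p : stdSimplex ℝ A) (q : stdSimplex ℝ B)
    (h : ∀ p', gameValue τ M p' q ≤ gameValue τ M p q) : p = softResponse τ M q := by
  have h1 := gameValue_softResponse_sub hτ M p q
  have h2 := h (softResponse τ M q)
  refine eq_of_relEntropy_nonpos _ _ (softResponse_pos τ M q) ?_
  by_contra! h3
  nlinarith [mul_pos hτ h3]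

/-- The response to `q₀` is nearly optimal against nearby `q`. -/
lemma gameValue_sub_softResponse_le [Nonempty A] {τ : ℝ} (hτ : 0 < τ) (M : A → B → ℝ) {c : ℝ}
    (hc : 0 ≤ c) (hM : ∀ a b, |M a b| ≤ c) (p : stdSimplex ℝ A) (q q₀ : stdSimplex ℝ B) :
    gameValue τ M p q - gameValue τ M (softResponse τ M q₀) q ≤
      2 * c ^ 2 / τ * l1Dist q₀ q ^ 2 := by
  have h1 := gameValue_le_softResponse hτ M p q
  have h2 := gameValue_softResponse_sub hτ M (softResponse τ M q₀) q
  obtain ⟨c₁, hc₁⟩ := log_gibbs fun a => (∑ b, M a b * q₀ b) / τ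
  obtain ⟨c₂, hc₂⟩ := log_gibbs fun a => (∑ b, M a b * q b) / τ
  -- The log-weights of the two responses differ by at most `c * l1Dist q₀ q / τ`, so the loss is
  -- quadratic in the distance.
  have h3 := relEntropy_le_of_log_sub (softResponse τ M q₀) (softResponse τ M q)
    (softResponse_pos _ _ _) (softResponse_pos _ _ _)
    (fun a => (∑ b, M a b * q₀ b - ∑ b, M a b * q b) / τ) (c₂ - c₁) (c * l1Dist q₀ q / τ)
    (div_nonneg (mul_nonneg hc (l1Dist_nonneg _ _)) hτ.le)
    (fun a => by
      rw [softResponse, softResponse, hc₁, hc₂]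
      ring)
    (fun a => by
      rw [abs_div, abs_of_pos hτ]
      exact div_le_div_of_nonneg_right (abs_sum_mul_sub_le q₀ q _ c (hM a)) hτ.le)
  have h4 := mul_le_mul_of_nonneg_left h3 hτ.le
  have h5 : τ * (2 * (c * l1Dist q₀ q / τ) ^ 2) = 2 * c ^ 2 / τ * l1Dist q₀ q ^ 2 := by
    field_simp
  linarith

/-- The uniform vector has maximal entropy, so the soft response can gain on it only through the
payoff, hence at most `2 c`. -/
lemma relEntropy_barycenter_softResponse_le [Nonempty A] {τ : ℝ} (hτ : 0 < τ) (M : A → B → ℝ)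
    {c : ℝ} (hM : ∀ a b, |M a b| ≤ c) (q : stdSimplex ℝ B) :
    τ * relEntropy stdSimplex.barycenter (softResponse τ M q) ≤ 2 * c := by
  rw [← gameValue_softResponse_sub hτ, gameValue_eq, gameValue_eq, entropy_barycenter]
  have h1 : ∀ p : stdSimplex ℝ A, |∑ a, p a * ∑ b, M a b * q b| ≤ c := fun p => by
    simp_rw [mul_comm (p _)]
    exact abs_sum_mul_simplex_le p _ c fun a => abs_sum_mul_simplex_le q _ c fun b => hM a b
  have h2 := abs_le.1 (h1 (softResponse τ M q))
  have h3 := abs_le.1 (h1 stdSimplex.barycenter)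
  have h4 := mul_le_mul_of_nonneg_left (entropy_le_log_card (softResponse τ M q)) hτ.le
  linarith [h2.2, h3.1]

/-- `(p, q)` is an equilibrium of the regularized matrix game. -/
structure IsEquilibrium (τ : ℝ) (M : A → B → ℝ) (p : stdSimplex ℝ A) (q : stdSimplex ℝ B) :
    Prop where
  max_le : ∀ p', gameValue τ M p' q ≤ gameValue τ M p q
  le_min : ∀ q', gameValue τ M p q ≤ gameValue τ M p q'

lemma IsEquilibrium.swap {τ : ℝ} {M : A → B → ℝ} {p : stdSimplex ℝ A} {q : stdSimplex ℝ B}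
    (h : IsEquilibrium τ M p q) : IsEquilibrium τ (fun b a => -M a b) q p :=
  ⟨fun q' => by simpa only [gameValue_swap, neg_le_neg_iff] using h.le_min q',
    fun p' => by simpa only [gameValue_swap, neg_le_neg_iff] using h.max_le p'⟩

lemma IsEquilibrium.eq_softResponse [Nonempty A] {τ : ℝ} (hτ : 0 < τ) {M : A → B → ℝ}
    {p : stdSimplex ℝ A} {q : stdSimplex ℝ B} (h : IsEquilibrium τ M p q) :
    p = softResponse τ M q := _root_.eq_softResponse hτ M p q h.max_le

lemma IsEquilibrium.pos [Nonempty A] {τ : ℝ} (hτ : 0 < τ) {M : A → B → ℝ}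
    {p : stdSimplex ℝ A} {q : stdSimplex ℝ B} (h : IsEquilibrium τ M p q) (a : A) : 0 < p a := by
  rw [h.eq_softResponse hτ]
  exact softResponse_pos _ _ _ _

/-- An equilibrium strategy is its own soft response; this quantifies strong concavity at the
equilibrium. -/
lemma IsEquilibrium.sub_eq [Nonempty A] {τ : ℝ} (hτ : 0 < τ) {M : A → B → ℝ}
    {p : stdSimplex ℝ A} {q : stdSimplex ℝ B} (h : IsEquilibrium τ M p q) (p' : stdSimplex ℝ A) :
    gameValue τ M p q - gameValue τ M p' q = τ * relEntropy p' p := by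
  have h1 := gameValue_softResponse_sub hτ M p' q
  rwa [← h.eq_softResponse hτ] at h1

/-- Equilibrium values depend nonexpansively on the matrix. -/
lemma IsEquilibrium.abs_sub_le {τ : ℝ} {M M' : A → B → ℝ} {p p' : stdSimplex ℝ A}
    {q q' : stdSimplex ℝ B} (h : IsEquilibrium τ M p q) (h' : IsEquilibrium τ M' p' q') {d : ℝ}
    (hd : ∀ a b, |M a b - M' a b| ≤ d) : |gameValue τ M p q - gameValue τ M' p' q'| ≤ d := by
  have h1 := abs_le.1 (abs_gameValue_sub_le τ M M' p q' d hd)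
  have h2 := abs_le.1 (abs_gameValue_sub_le τ M M' p' q d hd)
  have h3 := h.max_le p'
  have h4 := h.le_min q'
  have h5 := h'.max_le p
  have h6 := h'.le_min q
  rw [abs_le]
  constructor <;> linarith [h1.1, h1.2, h2.1, h2.2]

/-- Concavity is coordinatewise, from that of `Real.negMulLog`; the constant `c` is there for the
opponent's entropy. -/
lemma concaveOn_linear_add_entropy {X : Type*} [Fintype X] {τ : ℝ} (hτ : 0 ≤ τ) (g : X → ℝ)
    (c : ℝ) : ConcaveOn ℝ (stdSimplex ℝ X)
      fun p : X → ℝ => ∑ x, (p x * g x + τ * Real.negMulLog (p x)) + c := by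
  refine ⟨convex_stdSimplex ℝ X, fun p hp q hq a b ha hb hab => ?_⟩
  have hc : c = a * c + b * c := by rw [← add_mul, hab, one_mul]
  simp only [smul_eq_mul]
  rw [show a * (∑ x, (p x * g x + τ * Real.negMulLog (p x)) + c) +
      b * (∑ x, (q x * g x + τ * Real.negMulLog (q x)) + c) =
      (∑ x, (a * (p x * g x + τ * Real.negMulLog (p x)) +
        b * (q x * g x + τ * Real.negMulLog (q x)))) + (a * c + b * c) by
      rw [Finset.sum_add_distrib (f := fun x => a * (p x * g x + τ * Real.negMulLog (p x))),
        ← Finset.mul_sum, ← Finset.mul_sum]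
      ring, ← hc]
  refine add_le_add (Finset.sum_le_sum fun x _ => ?_) le_rfl
  have h := Real.concaveOn_negMulLog.2 (hp.1 x : p x ∈ Set.Ici 0) (hq.1 x : q x ∈ Set.Ici 0)
    ha hb hab
  simp only [smul_eq_mul] at h
  simp only [Pi.add_apply, Pi.smul_apply, smul_eq_mul]
  nlinarith [mul_le_mul_of_nonneg_left h hτ]

/-- Existence of equilibria. -/
lemma exists_isEquilibrium [Nonempty A] [Nonempty B] {τ : ℝ} (hτ : 0 ≤ τ) (M : A → B → ℝ) :
    ∃ p q, IsEquilibrium τ M p q := by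
  -- The payoff on the ambient spaces, as Sion's theorem requires, with the minimizing variable
  -- first.
  let f : (B → ℝ) → (A → ℝ) → ℝ := fun q p =>
    (∑ a, ∑ b, p a * M a b * q b) + τ * ∑ a, Real.negMulLog (p a) - τ * ∑ b, Real.negMulLog (q b)
  have hent : ∀ p : stdSimplex ℝ A, entropy p = ∑ x, Real.negMulLog (p x) := fun p => by
    simp [entropy, Real.negMulLog]
  have hent' : ∀ p : stdSimplex ℝ B, entropy p = ∑ x, Real.negMulLog (p x) := fun p => by
    simp [entropy, Real.negMulLog]
  have hfg : ∀ (p : stdSimplex ℝ A) (q : stdSimplex ℝ B), f q p = gameValue τ M p q :=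
    fun p q => by rw [gameValue, hent, hent']
  have hq : ∀ p : A → ℝ, (f · p) = fun q =>
      -(∑ b, (q b * (-∑ a, p a * M a b) + τ * Real.negMulLog (q b)) +
        -(τ * ∑ a, Real.negMulLog (p a))) := fun p => by
    funext q
    simp only [f]
    rw [Finset.sum_comm, Finset.sum_add_distrib, ← Finset.mul_sum]
    simp only [← Finset.sum_mul, mul_comm (q _), neg_mul, Finset.sum_neg_distrib]
    ring
  have hp : ∀ q : B → ℝ, f q = fun p =>
      ∑ a, (p a * (∑ b, M a b * q b) + τ * Real.negMulLog (p a)) +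
        -(τ * ∑ b, Real.negMulLog (q b)) := fun q => by
    funext p
    simp only [f]
    rw [Finset.sum_add_distrib, ← Finset.mul_sum]
    simp only [Finset.mul_sum, mul_assoc]
    ring
  have hcont : Continuous fun z : (B → ℝ) × (A → ℝ) => f z.1 z.2 := by
    simp only [f]
    fun_prop
  obtain ⟨q, hqm, p, hpm, h⟩ := Sion.exists_isSaddlePointOn (f := f)
    (X := stdSimplex ℝ B) (Y := stdSimplex ℝ A)
    ⟨_, (stdSimplex.barycenter : stdSimplex ℝ B).2⟩ (convex_stdSimplex ℝ B)
    (isCompact_stdSimplex ℝ B)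
    (fun p _ => (hcont.comp (by fun_prop : Continuous fun q : B → ℝ =>
      (q, p))).lowerSemicontinuous.lowerSemicontinuousOn _)
    (fun p _ => by
      rw [hq p]
      exact (concaveOn_linear_add_entropy hτ _ _).neg.quasiconvexOn)
    (convex_stdSimplex ℝ A) ⟨_, (stdSimplex.barycenter : stdSimplex ℝ A).2⟩
    (isCompact_stdSimplex ℝ A)
    (fun q _ => (hcont.comp (by fun_prop : Continuous fun p : A → ℝ =>
      (q, p))).upperSemicontinuous.upperSemicontinuousOn _)
    (fun q _ => by
      rw [hp q]
      exact (concaveOn_linear_add_entropy hτ _ _).quasiconcaveOn)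
  refine ⟨⟨p, hpm⟩, ⟨q, hqm⟩, fun p' => ?_, fun q' => ?_⟩
  · rw [← hfg, ← hfg]
    exact h q hqm p' p'.2
  · rw [← hfg, ← hfg]
    exact h q' q'.2 p hpm

end MatrixGame

/-! ### One step of optimistic multiplicative weights in a matrix game -/

section OptimisticStep

variable {A B : Type*} [Fintype A] [Fintype B]

/-- One optimistic step from `(p, q)` with predictions `(pb, qb)` to `(p', q')` with predictions
`(pb', qb')`, driven by matrices `M`, `M'` that approximate `M₀` with equilibrium `(p₀, q₀)`. -/
structure IsOptimisticStep (η τ c d d' : ℝ) (M M' M₀ : A → B → ℝ)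
    (p pb p' pb' p₀ : stdSimplex ℝ A) (q qb q' qb' q₀ : stdSimplex ℝ B) : Prop where
  pos_left : ∀ a, 0 < p a
  pos_right : ∀ b, 0 < q b
  pos_left_bar : ∀ a, 0 < pb a
  pos_right_bar : ∀ b, 0 < qb b
  bar_left : pb' = expUpdate η τ p fun a => ∑ b, M a b * qb b
  bar_right : qb' = expUpdate η τ q fun b => ∑ a, -M a b * pb a
  left : p' = expUpdate η τ p fun a => ∑ b, M' a b * qb' b
  right : q' = expUpdate η τ q fun b => ∑ a, -M' a b * pb' a
  bound : ∀ a b, |M a b| ≤ c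
  bound' : ∀ a b, |M' a b| ≤ c
  close : ∀ a b, |M a b - M₀ a b| ≤ d
  close' : ∀ a b, |M' a b - M₀ a b| ≤ d'
  equilibrium : IsEquilibrium τ M₀ p₀ q₀

namespace IsOptimisticStep

variable {η τ c d d' : ℝ} {M M' M₀ : A → B → ℝ} {p pb p' pb' p₀ : stdSimplex ℝ A}
  {q qb q' qb' q₀ : stdSimplex ℝ B}

/-- The step seen by the other player; bounds below are proved for the max player and reused through
`h.swap`. -/
lemma swap (h : IsOptimisticStep η τ c d d' M M' M₀ p pb p' pb' p₀ q qb q' qb' q₀) :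
    IsOptimisticStep η τ c d d' (fun b a => -M a b) (fun b a => -M' a b) (fun b a => -M₀ a b)
      q qb q' qb' q₀ p pb p' pb' p₀ where
  pos_left := h.pos_right
  pos_right := h.pos_left
  pos_left_bar := h.pos_right_bar
  pos_right_bar := h.pos_left_bar
  bar_left := h.bar_right
  bar_right := by simpa only [neg_neg] using h.bar_left
  left := h.right
  right := by simpa only [neg_neg] using h.left
  bound b a := by simpa only [abs_neg] using h.bound a b
  bound' b a := by simpa only [abs_neg] using h.bound' a b
  close b a := by
    rw [← neg_sub', abs_neg]
    exact h.close a b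
  close' b a := by
    rw [← neg_sub', abs_neg]
    exact h.close' a b
  equilibrium := h.equilibrium.swap

lemma pos_left_bar' (h : IsOptimisticStep η τ c d d' M M' M₀ p pb p' pb' p₀ q qb q' qb' q₀)
    (a : A) : 0 < pb' a := by
  rw [h.bar_left]
  exact expUpdate_pos _ _ _ h.pos_left _ _

lemma const_nonneg (h : IsOptimisticStep η τ c d d' M M' M₀ p pb p' pb' p₀ q qb q' qb' q₀) :
    0 ≤ c ∧ 0 ≤ d ∧ 0 ≤ d' := by
  obtain ⟨a, -⟩ := exists_pos p
  obtain ⟨b, -⟩ := exists_pos q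
  exact ⟨(abs_nonneg _).trans (h.bound a b), (abs_nonneg _).trans (h.close a b),
    (abs_nonneg _).trans (h.close' a b)⟩

/-- The prediction error of the max player is of second order. -/
lemma relEntropy_bar_le (h : IsOptimisticStep η τ c d d' M M' M₀ p pb p' pb' p₀ q qb q' qb' q₀)
    (hη : 0 ≤ η) :
    relEntropy pb' p' + relEntropy p' pb' ≤ 4 * η ^ 2 * c * (d + d') +
      2 * η * c * (2 * relEntropy p' pb' + relEntropy q qb + relEntropy qb' q) := by
  obtain ⟨hc, hd, hd'⟩ := h.const_nonneg
  -- Prediction and update see payoffs that differ by the change of matrix and by the movement of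
  -- the opponent's prediction.
  have hdiff : ∀ a, |∑ b, M a b * qb b - ∑ b, M' a b * qb' b| ≤ d + d' + c * l1Dist qb qb' := by
    intro a
    have h1 := abs_sum_mul_sub_le qb qb' (M a) c (h.bound a)
    have h2 : |∑ b, (M a b - M' a b) * qb' b| ≤ d + d' := by
      refine abs_sum_mul_simplex_le qb' _ _ fun b => ?_
      have h3 := abs_sub_le (M a b) (M₀ a b) (M' a b)
      rw [abs_sub_comm (M₀ a b)] at h3
      linarith [h.close a b, h.close' a b]
    simp only [sub_mul, Finset.sum_sub_distrib] at h2
    have h3 := abs_sub_le (∑ b, M a b * qb b) (∑ b, M a b * qb' b) (∑ b, M' a b * qb' b)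
    linarith
  -- A crude bound, giving `l1Dist pb' p' ≤ 4 η c`; multiplied by `η (d + d')` it produces the `η ^
  -- 2` term.
  have hdiff' : ∀ a, |∑ b, M a b * qb b - ∑ b, M' a b * qb' b| ≤ 2 * c := by
    intro a
    have h1 := abs_sum_mul_simplex_le qb (M a) c (h.bound a)
    have h2 := abs_sum_mul_simplex_le qb' (M' a) c (h.bound' a)
    have h3 := abs_sub (∑ b, M a b * qb b) (∑ b, M' a b * qb' b)
    linarith
  have h1 := relEntropy_expUpdate_le η τ hη p h.pos_left _ _ _ hdiff
  have h2 := l1Dist_expUpdate_le η τ hη p h.pos_left _ _ _ (by positivity) hdiff'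
  rw [← h.bar_left, ← h.left] at h1 h2
  have h3 := l1Dist_triangle qb q qb'
  have h4 := sq_l1Dist_le p' pb' h.pos_left_bar'
  have h5 := sq_l1Dist_le q qb h.pos_right_bar
  have h6 := sq_l1Dist_le qb' q h.pos_right
  rw [l1Dist_comm p' pb'] at h4
  rw [l1Dist_comm q qb] at h5
  rw [l1Dist_comm qb' q] at h6
  have h0 := l1Dist_nonneg pb' p'
  -- The triangle inequality through `q`, then the arithmetic-geometric mean and Pinsker; the
  -- direction from `p'` to `pb'` is the one kept on the left.
  have h7 : l1Dist pb' p' * l1Dist qb qb' ≤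
      2 * (2 * relEntropy p' pb' + relEntropy q qb + relEntropy qb' q) := by
    nlinarith [mul_le_mul_of_nonneg_left h3 h0, sq_nonneg (l1Dist pb' p' - l1Dist qb q),
      sq_nonneg (l1Dist pb' p' - l1Dist q qb')]
  have h8 := mul_le_mul_of_nonneg_left h7 (mul_nonneg hη hc)
  have h9 := mul_le_mul_of_nonneg_left h2 (mul_nonneg hη (add_nonneg hd hd'))
  nlinarith

/-- The regret of the max player against its equilibrium strategy. -/
lemma regret_le (h : IsOptimisticStep η τ c d d' M M' M₀ p pb p' pb' p₀ q qb q' qb' q₀)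
    (hη : 0 ≤ η) (hητ : η * τ ≤ 1) :
    η * (gameValue τ M₀ p₀ q₀ - gameValue τ M' pb' qb') ≤ η * d' +
      ((1 - η * τ) * relEntropy p₀ p - relEntropy p₀ p') + (4 * η ^ 2 * c * (d + d') +
        2 * η * c * (2 * relEntropy p' pb' + relEntropy q qb + relEntropy qb' q)) := by
  have h1 := expUpdate_regret η τ p h.pos_left (fun a => ∑ b, M' a b * qb' b) p₀ pb'
  rw [← h.left] at h1
  have h2 := h.relEntropy_bar_le hη
  have h3 := mul_nonneg (sub_nonneg.2 hητ) (relEntropy_nonneg pb' p h.pos_left)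
  have h4 := relEntropy_nonneg p' pb' h.pos_left_bar'
  -- The strategy `p₀` secures the value of `M₀` against `qb'`, hence up to `d'` also in `M'`;
  -- mirror descent evaluates what remains.
  have h5 := (abs_le.1 (abs_gameValue_sub_le τ M' M₀ p₀ qb' d' h.close')).1
  have h6 := h.equilibrium.le_min qb'
  have h7 : gameValue τ M₀ p₀ q₀ - gameValue τ M' pb' qb' ≤
      d' + (gameValue τ M' p₀ qb' - gameValue τ M' pb' qb') := by linarith
  have h8 := mul_le_mul_of_nonneg_left h7 hη
  have g1 := gameValue_eq τ M' p₀ qb'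
  have g2 := gameValue_eq τ M' pb' qb'
  have h9 : η * (gameValue τ M' p₀ qb' - gameValue τ M' pb' qb') =
      (1 - η * τ) * relEntropy p₀ p - relEntropy p₀ p' + relEntropy pb' p' -
        (1 - η * τ) * relEntropy pb' p := by
    rw [← h1]
    linear_combination η * (g1 - g2)
  linarith

/-- Contraction of the relative entropy to the equilibrium. -/
lemma relEntropy_step_le [Nonempty A] [Nonempty B]
    (h : IsOptimisticStep η τ c d d' M M' M₀ p pb p' pb' p₀ q qb q' qb' q₀)
    (hη : 0 ≤ η) (hτ : 0 < τ) :
    (relEntropy p₀ p' + relEntropy q₀ q') + (relEntropy p' pb' + relEntropy q' qb') +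
        (1 - η * τ) * (relEntropy pb' p + relEntropy qb' q) +
        η * τ * (relEntropy pb' p₀ + relEntropy qb' q₀) ≤
      (1 - η * τ) * (relEntropy p₀ p + relEntropy q₀ q) + 2 * η * d' +
        8 * η ^ 2 * c * (d + d') + 2 * η * c * (2 * (relEntropy p' pb' + relEntropy q' qb') +
          (relEntropy p pb + relEntropy q qb) + (relEntropy pb' p + relEntropy qb' q)) := by
  have h1 := expUpdate_regret η τ p h.pos_left (fun a => ∑ b, M' a b * qb' b) p₀ pb'
  have h2 := expUpdate_regret η τ q h.pos_right (fun b => ∑ a, -M' a b * pb' a) q₀ qb'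
  rw [← h.left] at h1
  rw [← h.right] at h2
  have h3 := h.relEntropy_bar_le hη
  have h4 := h.swap.relEntropy_bar_le hη
  have g1 := gameValue_eq τ M' p₀ qb'
  have g2 := gameValue_eq τ M' pb' qb'
  have g3 := gameValue_eq τ (fun b a => -M' a b) q₀ pb'
  have g4 := gameValue_eq τ (fun b a => -M' a b) qb' pb'
  rw [gameValue_swap] at g3 g4
  have e1 := h.equilibrium.sub_eq hτ pb'
  have e2 := h.equilibrium.swap.sub_eq hτ qb'
  rw [gameValue_swap, gameValue_swap] at e2
  have h5 := (abs_le.1 (abs_gameValue_sub_le τ M' M₀ p₀ qb' d' h.close')).1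
  have h6 := (abs_le.1 (abs_gameValue_sub_le τ M' M₀ pb' q₀ d' h.close')).2
  -- Deviations of the predictions from equilibrium cost `τ` times their divergence, the source of
  -- the extra term on the left of the claim.
  have h7 : τ * relEntropy pb' p₀ + τ * relEntropy qb' q₀ - 2 * d' ≤
      gameValue τ M' p₀ qb' - gameValue τ M' pb' q₀ := by linarith
  have h8 := mul_le_mul_of_nonneg_left h7 hη
  -- In the sum of the two mirror descent identities the payoff of `(pb', qb')` cancels, the game
  -- being zero-sum.
  have h9 : η * (gameValue τ M' p₀ qb' - gameValue τ M' pb' q₀) =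
      ((1 - η * τ) * relEntropy p₀ p - relEntropy p₀ p' + relEntropy pb' p' -
        (1 - η * τ) * relEntropy pb' p) +
      ((1 - η * τ) * relEntropy q₀ q - relEntropy q₀ q' + relEntropy qb' q' -
        (1 - η * τ) * relEntropy qb' q) := by
    rw [← h1, ← h2]
    linear_combination η * (g1 - g2 + g3 - g4)
  linarith

end IsOptimisticStep

end OptimisticStep

/-! ### Trajectories and values -/

instance instFintypeStep (S A B : Type*) [Fintype S] [Fintype A] [Fintype B] :
    Fintype (Step S A B) :=
  Fintype.ofEquiv (S × A × B)
    { toFun := fun x => ⟨x.1, x.2.1, x.2.2⟩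
      invFun := fun x => (x.state, x.maxAct, x.minAct)
      left_inv := fun _ => rfl
      right_inv := fun _ => rfl }

lemma PMF.sum_bind_toReal_mul {X Y : Type*} [Fintype X] [Fintype Y] (p : PMF X) (k : X → PMF Y)
    (f : Y → ℝ) : ∑ y, (p.bind k y).toReal * f y =
      ∑ x, (p x).toReal * ∑ y, (k x y).toReal * f y := by
  have h : ∀ y, (p.bind k y).toReal = ∑ x, (p x).toReal * (k x y).toReal := fun y => by
    rw [PMF.bind_apply, tsum_fintype, ENNReal.toReal_sum]
    · simp only [ENNReal.toReal_mul]
    · exact fun x _ => ENNReal.mul_ne_top (p.apply_ne_top x) ((k x).apply_ne_top y)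
  simp only [h, Finset.sum_mul, Finset.mul_sum]
  rw [Finset.sum_comm]
  exact Finset.sum_congr rfl fun x _ => Finset.sum_congr rfl fun y _ => by ring

lemma PMF.sum_pure_toReal_mul {Y : Type*} [Fintype Y] (y₀ : Y) (f : Y → ℝ) :
    ∑ y, (PMF.pure y₀ y).toReal * f y = f y₀ := by
  classical
  rw [Finset.sum_eq_single y₀]
  · simp
  · intro y _ hy
    simp [PMF.pure_apply, hy]
  · simp

lemma simplexPMF_toReal {X : Type*} [Fintype X] (p : stdSimplex ℝ X) (x : X) :
    (simplexPMF p x).toReal = p x :=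
  ENNReal.toReal_ofReal (p.2.1 x)

namespace MarkovGame

variable {S A B : Type*} [Fintype S] [Fintype A] [Fintype B]

/-- Average over the actions of a function of the state and the actions. -/
def actAvg (μ : Policy S A) (ν : Policy S B) (f : Step S A B → ℝ) (s : S) : ℝ :=
  ∑ a, μ s a * ∑ b, ν s b * f ⟨s, a, b⟩

/-- Expectation over the next state. -/
def nextAvg (G : MarkovGame S A B) (W : S → ℝ) (x : Step S A B) : ℝ :=
  ∑ s', G.trans x.state x.maxAct x.minAct s' * W s'

lemma actAvg_state (μ : Policy S A) (ν : Policy S B) (W : S → ℝ) (s : S) :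
    actAvg μ ν (fun x => W x.state) s = W s := by
  simp only [actAvg, ← Finset.sum_mul, stdSimplex.sum_eq_one, one_mul]

lemma integral_actPMF (μ : Policy S A) (ν : Policy S B) (f : Step S A B → ℝ) (s : S) :
    ∫ x, f x ∂(actPMF μ ν s).toMeasure = actAvg μ ν f s := by
  rw [PMF.integral_eq_sum]
  simp only [smul_eq_mul, actPMF, PMF.sum_bind_toReal_mul, PMF.sum_pure_toReal_mul,
    simplexPMF_toReal, actAvg]

lemma integral_stepKernel (G : MarkovGame S A B) (μ : Policy S A) (ν : Policy S B)
    (f : Step S A B → ℝ) (x : Step S A B) :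
    ∫ y, f y ∂(G.stepKernel μ ν x) = G.nextAvg (actAvg μ ν f) x := by
  change ∫ y, f y ∂((simplexPMF (G.trans x.state x.maxAct x.minAct)).bind
    (actPMF μ ν)).toMeasure = _
  rw [PMF.integral_eq_sum]
  simp only [smul_eq_mul, actPMF, PMF.sum_bind_toReal_mul, PMF.sum_pure_toReal_mul,
    simplexPMF_toReal, actAvg, nextAvg]

instance (G : MarkovGame S A B) (μ : Policy S A) (ν : Policy S B) (s : S) :
    IsProbabilityMeasure (G.pathLaw μ ν s) := by
  unfold pathLaw
  infer_instance

lemma integrable_coord (G : MarkovGame S A B) (μ : Policy S A) (ν : Policy S B) (s : S)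
    (f : Step S A B → ℝ) (t : ℕ) : Integrable (fun ω => f (ω t)) (G.pathLaw μ ν s) := by
  obtain ⟨C, hC⟩ := (Set.finite_range fun x => ‖f x‖).bddAbove
  refine Integrable.of_bound ?_ C (Filter.Eventually.of_forall fun ω => hC ⟨ω t, rfl⟩)
  exact ((measurable_from_top (f := f)).comp (measurable_pi_apply t)).aestronglyMeasurable

lemma integral_coord_zero (G : MarkovGame S A B) (μ : Policy S A) (ν : Policy S B) (s : S)
    (f : Step S A B → ℝ) : ∫ ω, f (ω 0) ∂(G.pathLaw μ ν s) = actAvg μ ν f s := by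
  have h : (G.pathLaw μ ν s).map (fun ω => ω 0) = (actPMF μ ν s).toMeasure := by
    have h1 : (fun ω : ℕ → Step S A B => ω 0) =
        (fun h : (i : Finset.Iic 0) → Step S A B => h ⟨0, Finset.mem_Iic.2 le_rfl⟩) ∘
          (Preorder.frestrictLe (π := fun _ => Step S A B) 0) := rfl
    rw [h1, ← Measure.map_map (measurable_pi_apply _) (by fun_prop), pathLaw,
      Kernel.trajMeasure, Measure.map_comp _ _ (by fun_prop), Kernel.traj_map_frestrictLe,
      Kernel.partialTraj_self, Measure.id_comp,
      Measure.map_map (measurable_pi_apply _) (by fun_prop)]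
    exact Measure.map_id
  rw [← integral_actPMF, ← h, integral_map (measurable_pi_apply 0).aemeasurable
    (measurable_from_top (f := f)).aestronglyMeasurable]

/-- The Markov property: history and next step are jointly distributed by a kernel that sees only
the last step of the history. -/
lemma integral_coord_succ (G : MarkovGame S A B) (μ : Policy S A) (ν : Policy S B) (s : S)
    (f : Step S A B → ℝ) (t : ℕ) : ∫ ω, f (ω (t + 1)) ∂(G.pathLaw μ ν s) =
      ∫ ω, G.nextAvg (actAvg μ ν f) (ω t) ∂(G.pathLaw μ ν s) := by
  have h := Kernel.map_frestrictLe_trajMeasure_compProd_eq_map_trajMeasure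
    (X := fun _ => Step S A B) (μ₀ := (actPMF μ ν s).toMeasure)
    (κ := fun n => (G.stepKernel μ ν).comap (fun h => h ⟨n, Finset.mem_Iic.2 le_rfl⟩)
      (measurable_pi_apply _)) (a := t)
  rw [← pathLaw] at h
  have hf : Measurable fun z : ((i : Finset.Iic t) → Step S A B) × Step S A B => f z.2 :=
    (measurable_from_top (f := f)).comp measurable_snd
  have h1 : ∫ ω, f (ω (t + 1)) ∂(G.pathLaw μ ν s) = ∫ z, f z.2 ∂((G.pathLaw μ ν s).map
      (fun x => (Preorder.frestrictLe (π := fun _ => Step S A B) t x, x (t + 1)))) := by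
    rw [integral_map (by fun_prop) hf.aestronglyMeasurable]
  rw [h1, ← h, Measure.integral_compProd, integral_map (by fun_prop)]
  · refine integral_congr_ae (Filter.Eventually.of_forall fun ω => ?_)
    exact G.integral_stepKernel μ ν f (ω t)
  · refine Measurable.aestronglyMeasurable ?_
    have h2 : (fun x : (i : Finset.Iic t) → Step S A B => ∫ y, f y ∂((G.stepKernel μ ν).comap
        (fun h => h ⟨t, Finset.mem_Iic.2 le_rfl⟩) (measurable_pi_apply _) x)) =
        (G.nextAvg (actAvg μ ν f)) ∘ fun x => x ⟨t, Finset.mem_Iic.2 le_rfl⟩ := by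
      funext x
      exact G.integral_stepKernel μ ν f _
    exact h2 ▸ (measurable_from_top (f := G.nextAvg (actAvg μ ν f))).comp (measurable_pi_apply _)
  · obtain ⟨C, hC⟩ := (Set.finite_range fun x => ‖f x‖).bddAbove
    rw [h]
    have : IsProbabilityMeasure ((G.pathLaw μ ν s).map
      (fun x => (Preorder.frestrictLe (π := fun _ => Step S A B) t x, x (t + 1)))) :=
      Measure.isProbabilityMeasure_map (by fun_prop)
    exact Integrable.of_bound hf.aestronglyMeasurable C
      (Filter.Eventually.of_forall fun z => hC ⟨z.2, rfl⟩)

/-- At each time the actions are drawn afresh given the state, and averaging over actions fixes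
functions of the state. -/
lemma integral_coord_eq_actAvg (G : MarkovGame S A B) (μ : Policy S A) (ν : Policy S B) (s : S)
    (f : Step S A B → ℝ) (t : ℕ) : ∫ ω, f (ω t) ∂(G.pathLaw μ ν s) =
      ∫ ω, actAvg μ ν f (ω t).state ∂(G.pathLaw μ ν s) := by
  cases t with
  | zero => rw [integral_coord_zero, integral_coord_zero G μ ν s
      (fun x => actAvg μ ν f x.state), actAvg_state]
  | succ t =>
    rw [integral_coord_succ, integral_coord_succ G μ ν s (fun x => actAvg μ ν f x.state)]
    simp only [funext (actAvg_state μ ν (actAvg μ ν f))]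

/-- The law of the state at time `t`. -/
def stateProb (G : MarkovGame S A B) (μ : Policy S A) (ν : Policy S B) (s : S) (t : ℕ) (s' : S) :
    ℝ :=
  (G.pathLaw μ ν s).real {ω | (ω t).state = s'}

lemma stateProb_nonneg (G : MarkovGame S A B) (μ : Policy S A) (ν : Policy S B) (s : S) (t : ℕ)
    (s' : S) : 0 ≤ G.stateProb μ ν s t s' := measureReal_nonneg

lemma stateProb_le_one (G : MarkovGame S A B) (μ : Policy S A) (ν : Policy S B) (s : S) (t : ℕ)
    (s' : S) : G.stateProb μ ν s t s' ≤ 1 := measureReal_le_one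

lemma integral_state (G : MarkovGame S A B) (μ : Policy S A) (ν : Policy S B) (s : S)
    (h : S → ℝ) (t : ℕ) : ∫ ω, h (ω t).state ∂(G.pathLaw μ ν s) =
      ∑ s', G.stateProb μ ν s t s' * h s' := by
  classical
  have hm : ∀ s', MeasurableSet {ω : ℕ → Step S A B | (ω t).state = s'} := fun s' =>
    (measurable_pi_apply (X := fun _ : ℕ => Step S A B) t)
      (MeasurableSpace.measurableSet_top (s := {x : Step S A B | x.state = s'}))
  have h1 : ∀ ω : ℕ → Step S A B, h (ω t).state =
      ∑ s', Set.indicator {ω : ℕ → Step S A B | (ω t).state = s'} (fun _ => h s') ω := fun ω => by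
    simp [Set.indicator_apply]
  simp only [h1]
  rw [integral_finsetSum _ fun s' _ => (integrable_const _).indicator (hm s')]
  refine Finset.sum_congr rfl fun s' _ => ?_
  rw [integral_indicator_const _ (hm s'), smul_eq_mul, stateProb]

lemma summable_discounted (G : MarkovGame S A B) {f : ℕ → ℝ} {C : ℝ} (hf : ∀ t, |f t| ≤ C) :
    Summable fun t => G.γ ^ t * f t := by
  refine Summable.of_norm_bounded ((summable_geometric_of_lt_one G.γ_nonneg G.γ_lt_one).mul_right C)
    fun t => ?_
  rw [norm_mul, Real.norm_of_nonneg (pow_nonneg G.γ_nonneg t)]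
  exact mul_le_mul_of_nonneg_left (hf t) (pow_nonneg G.γ_nonneg t)

/-- The discounted state visitation distribution started in `s`. -/
def visit (G : MarkovGame S A B) (μ : Policy S A) (ν : Policy S B) (s s' : S) : ℝ :=
  (1 - G.γ) * ∑' t : ℕ, G.γ ^ t * G.stateProb μ ν s t s'

lemma abs_stateProb_le (G : MarkovGame S A B) (μ : Policy S A) (ν : Policy S B) (s s' : S)
    (t : ℕ) : |G.stateProb μ ν s t s'| ≤ 1 := by
  rw [abs_of_nonneg (G.stateProb_nonneg μ ν s t s')]
  exact G.stateProb_le_one μ ν s t s'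

lemma visit_nonneg (G : MarkovGame S A B) (μ : Policy S A) (ν : Policy S B) (s s' : S) :
    0 ≤ G.visit μ ν s s' :=
  mul_nonneg (sub_nonneg.2 G.γ_lt_one.le) (tsum_nonneg fun t =>
    mul_nonneg (pow_nonneg G.γ_nonneg t) (G.stateProb_nonneg μ ν s t s'))

lemma visit_le_one (G : MarkovGame S A B) (μ : Policy S A) (ν : Policy S B) (s s' : S) :
    G.visit μ ν s s' ≤ 1 := by
  have h1 : ∑' t : ℕ, G.γ ^ t * G.stateProb μ ν s t s' ≤ ∑' t : ℕ, G.γ ^ t :=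
    (G.summable_discounted (G.abs_stateProb_le μ ν s s')).tsum_le_tsum (fun t =>
      mul_le_of_le_one_right (pow_nonneg G.γ_nonneg t) (G.stateProb_le_one μ ν s t s'))
      (summable_geometric_of_lt_one G.γ_nonneg G.γ_lt_one)
  rw [tsum_geometric_of_lt_one G.γ_nonneg G.γ_lt_one] at h1
  have h2 := sub_pos.2 G.γ_lt_one
  have h3 := mul_le_mul_of_nonneg_left h1 h2.le
  rwa [mul_inv_cancel₀ h2.ne'] at h3

lemma visitation_eq (G : MarkovGame S A B) (ρ : stdSimplex ℝ S) (μ : Policy S A)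
    (ν : Policy S B) (s : S) : G.visitation ρ μ ν s = ∑ s₀, ρ s₀ * G.visit μ ν s₀ s := by
  rw [visitation, Finset.mul_sum]
  exact Finset.sum_congr rfl fun s₀ _ => by rw [visit]; simp only [stateProb]; ring

/-- The state-action values of a continuation value `W`. -/
def qFun (G : MarkovGame S A B) (W : S → ℝ) (s : S) (a : A) (b : B) : ℝ :=
  G.reward s a b + G.γ * ∑ s', G.trans s a b s' * W s'

/-- The regularized one-step reward. -/
def regReward (G : MarkovGame S A B) (τ : ℝ) (μ : Policy S A) (ν : Policy S B)
    (x : Step S A B) : ℝ :=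
  G.reward x.state x.maxAct x.minAct - τ * Real.log (μ x.state x.maxAct)
    + τ * Real.log (ν x.state x.minAct)

/-- The step space is finite, so the regularized reward is bounded, even where a policy vanishes
since `Real.log 0 = 0`; geometric domination allows the interchange. -/
lemma value_eq_tsum (G : MarkovGame S A B) (τ : ℝ) (μ : Policy S A) (ν : Policy S B) (s : S) :
    G.value τ μ ν s =
      ∑' t : ℕ, G.γ ^ t * ∫ ω, G.regReward τ μ ν (ω t) ∂(G.pathLaw μ ν s) := by
  obtain ⟨C, hC⟩ := (Set.finite_range fun x => ‖G.regReward τ μ ν x‖).bddAbove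
  have hi : ∀ t, Integrable (fun ω => G.γ ^ t * G.regReward τ μ ν (ω t)) (G.pathLaw μ ν s) :=
    fun t => (G.integrable_coord μ ν s _ t).const_mul _
  change ∫ ω, ∑' t : ℕ, G.γ ^ t * G.regReward τ μ ν (ω t) ∂(G.pathLaw μ ν s) = _
  rw [← integral_tsum_of_summable_integral_norm hi]
  · simp only [integral_const_mul]
  · refine Summable.of_nonneg_of_le (fun t => integral_nonneg fun _ => norm_nonneg _) (fun t => ?_)
      ((summable_geometric_of_lt_one G.γ_nonneg G.γ_lt_one).mul_right C)
    calc ∫ ω, ‖G.γ ^ t * G.regReward τ μ ν (ω t)‖ ∂(G.pathLaw μ ν s)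
        ≤ ∫ _, G.γ ^ t * C ∂(G.pathLaw μ ν s) := by
          refine integral_mono (hi t).norm (integrable_const _) fun ω => ?_
          simp only [norm_mul, Real.norm_of_nonneg (pow_nonneg G.γ_nonneg t)]
          exact mul_le_mul_of_nonneg_left (hC ⟨ω t, rfl⟩) (pow_nonneg G.γ_nonneg t)
      _ = G.γ ^ t * C := by simp

/-- The logarithms average to entropies, so the expected Bellman residual is that of the stage game.
-/
lemma actAvg_bellman (G : MarkovGame S A B) (τ : ℝ) (μ : Policy S A) (ν : Policy S B)
    (W : S → ℝ) (s : S) :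
    actAvg μ ν (fun x => G.regReward τ μ ν x + G.γ * G.nextAvg W x - W x.state) s =
      gameValue τ (G.qFun W s) (μ s) (ν s) - W s := by
  have h1 : ∀ a b, G.regReward τ μ ν ⟨s, a, b⟩ + G.γ * G.nextAvg W ⟨s, a, b⟩ - W s =
      G.qFun W s a b - τ * Real.log (μ s a) + τ * Real.log (ν s b) - W s := fun a b => by
    simp only [regReward, nextAvg, qFun]
    ring
  have h2 : ∀ a, ∑ b, ν s b * (G.qFun W s a b - τ * Real.log (μ s a) + τ * Real.log (ν s b) - W s)
      = ∑ b, G.qFun W s a b * ν s b - τ * Real.log (μ s a) - τ * entropy (ν s) - W s := fun a => by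
    have h3 : ∑ b, ν s b * (-τ * Real.log (μ s a) - W s) = -τ * Real.log (μ s a) - W s := by
      rw [← Finset.sum_mul, stdSimplex.sum_eq_one, one_mul]
    have h4 : - τ * entropy (ν s) = ∑ b, τ * (ν s b * Real.log (ν s b)) := by
      rw [entropy, ← Finset.mul_sum]
      ring
    rw [show ∀ x y z w : ℝ, x - y * z - y * w - W s = x + (-y * z - W s) + -y * w by intros; ring,
      ← h3, h4, ← Finset.sum_add_distrib, ← Finset.sum_add_distrib]
    exact Finset.sum_congr rfl fun b _ => by ring
  have h5 : ∑ a, μ s a * (-τ * entropy (ν s) - W s) = -τ * entropy (ν s) - W s := by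
    rw [← Finset.sum_mul, stdSimplex.sum_eq_one, one_mul]
  have h6 : τ * entropy (μ s) = ∑ a, -τ * (μ s a * Real.log (μ s a)) := by
    rw [entropy, ← Finset.mul_sum]
    ring
  simp only [actAvg, h1, h2]
  rw [gameValue_eq, h6, show ∀ x y z w : ℝ, x + y - z * w - W s = x + y + (-z * w - W s) by
    intros; ring, ← h5, ← Finset.sum_add_distrib, ← Finset.sum_add_distrib]
  exact Finset.sum_congr rfl fun a _ => by ring

lemma abs_integral_coord_le (G : MarkovGame S A B) (μ : Policy S A) (ν : Policy S B) (s : S)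
    (f : Step S A B → ℝ) : ∃ C, ∀ t, |∫ ω, f (ω t) ∂(G.pathLaw μ ν s)| ≤ C := by
  obtain ⟨C, hC⟩ := (Set.finite_range fun x => ‖f x‖).bddAbove
  refine ⟨C, fun t => ?_⟩
  have := norm_integral_le_of_norm_le_const (μ := G.pathLaw μ ν s) (f := fun ω => f (ω t))
    (Filter.Eventually.of_forall fun ω => hC ⟨ω t, rfl⟩)
  simpa using this

/-- The performance difference identity. -/
lemma value_sub_eq (G : MarkovGame S A B) (τ : ℝ) (μ : Policy S A) (ν : Policy S B)
    (W : S → ℝ) (s : S) :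
    (1 - G.γ) * (G.value τ μ ν s - W s) =
      ∑ s', G.visit μ ν s s' * (gameValue τ (G.qFun W s') (μ s') (ν s') - W s') := by
  set E : (Step S A B → ℝ) → ℕ → ℝ := fun f t => ∫ ω, f (ω t) ∂(G.pathLaw μ ν s) with hE
  have hsum : ∀ f, Summable fun t => G.γ ^ t * E f t := fun f => by
    obtain ⟨C, hC⟩ := G.abs_integral_coord_le μ ν s f
    exact G.summable_discounted hC
  have hnext : ∀ t, E (G.nextAvg W) t = E (fun x => W x.state) (t + 1) := fun t => by
    simp only [hE]
    rw [integral_coord_succ G μ ν s (fun x => W x.state), funext (actAvg_state μ ν W)]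
  -- Telescoping: the continuation value at time `t` is the state value at time `t + 1`, so only `W
  -- s` survives.
  have htel : ∑' t, G.γ ^ t * E (fun x => W x.state) t =
      W s + ∑' t, G.γ ^ t * (G.γ * E (G.nextAvg W) t) := by
    rw [(hsum fun x => W x.state).tsum_eq_zero_add]
    congr 1
    · simp only [hE, pow_zero, one_mul]
      rw [integral_coord_zero G μ ν s (fun x => W x.state), actAvg_state]
    · exact tsum_congr fun t => by rw [hnext, pow_succ]; ring
  have hlin : ∀ t, E (fun x => G.regReward τ μ ν x + G.γ * G.nextAvg W x - W x.state) t =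
      E (G.regReward τ μ ν) t + G.γ * E (G.nextAvg W) t - E (fun x => W x.state) t := fun t => by
    simp only [hE]
    rw [integral_sub, integral_add, integral_const_mul]
    · exact G.integrable_coord μ ν s _ t
    · exact (G.integrable_coord μ ν s _ t).const_mul _
    · exact (G.integrable_coord μ ν s _ t).add ((G.integrable_coord μ ν s _ t).const_mul _)
    · exact G.integrable_coord μ ν s (fun x => W x.state) t
  have hstep : ∀ t, E (fun x => G.regReward τ μ ν x + G.γ * G.nextAvg W x - W x.state) t =
      ∑ s', G.stateProb μ ν s t s' *
        (gameValue τ (G.qFun W s') (μ s') (ν s') - W s') := fun t => by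
    simp only [hE]
    rw [integral_coord_eq_actAvg G μ ν s
      (fun x => G.regReward τ μ ν x + G.γ * G.nextAvg W x - W x.state)]
    simp only [actAvg_bellman]
    exact G.integral_state μ ν s (fun s' => gameValue τ (G.qFun W s') (μ s') (ν s') - W s') t
  have hγ : Summable fun t => G.γ ^ t * (G.γ * E (G.nextAvg W) t) :=
    ((hsum (G.nextAvg W)).mul_left G.γ).congr fun t => by ring
  have hV : G.value τ μ ν s - W s = ∑' t, G.γ ^ t *
      E (fun x => G.regReward τ μ ν x + G.γ * G.nextAvg W x - W x.state) t := by
    simp only [hlin, mul_sub, mul_add]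
    rw [((hsum (G.regReward τ μ ν)).add hγ).tsum_sub (hsum fun x => W x.state),
      (hsum (G.regReward τ μ ν)).tsum_add hγ, htel, value_eq_tsum]
    ring
  rw [hV]
  simp only [hstep, Finset.mul_sum]
  rw [Summable.tsum_finsetSum, Finset.mul_sum]
  · refine Finset.sum_congr rfl fun s' _ => ?_
    rw [visit, mul_assoc, ← tsum_mul_right]
    simp only [mul_assoc]
  · exact fun s' _ => ((G.summable_discounted (G.abs_stateProb_le μ ν s s')).mul_right
      (gameValue τ (G.qFun W s') (μ s') (ν s') - W s')).congr fun t => by ring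

lemma valueAt_sub_eq (G : MarkovGame S A B) (τ : ℝ) (μ : Policy S A) (ν : Policy S B)
    (ρ : stdSimplex ℝ S) (W : S → ℝ) :
    (1 - G.γ) * (G.valueAt τ μ ν ρ - ∑ s, ρ s * W s) =
      ∑ s, G.visitation ρ μ ν s * (gameValue τ (G.qFun W s) (μ s) (ν s) - W s) := by
  rw [valueAt, ← Finset.sum_sub_distrib, Finset.mul_sum]
  simp only [visitation_eq, Finset.sum_mul]
  rw [Finset.sum_comm]
  refine Finset.sum_congr rfl fun s _ => ?_
  rw [← mul_sub, mul_left_comm, value_sub_eq, Finset.mul_sum]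
  exact Finset.sum_congr rfl fun s' _ => by ring

/-! ### Fixed points -/

/-- The bound stays a mean over the next state instead of a supremum, so that the transition can be
charged to a reachable distribution. -/
lemma abs_qFun_sub_le (G : MarkovGame S A B) (W W' : S → ℝ) (s : S) (a : A) (b : B) :
    |G.qFun W s a b - G.qFun W' s a b| ≤ G.γ * ∑ s', G.trans s a b s' * |W s' - W' s'| := by
  rw [qFun, qFun, add_sub_add_left_eq_sub, ← mul_sub, abs_mul, abs_of_nonneg G.γ_nonneg,
    ← Finset.sum_sub_distrib]
  refine mul_le_mul_of_nonneg_left ((Finset.abs_sum_le_sum_abs _ _).trans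
    (Finset.sum_le_sum fun s' _ => ?_)) G.γ_nonneg
  rw [← mul_sub, abs_mul, abs_of_nonneg (stdSimplex.zero_le _ s')]

/-- A nonexpansive stage operator has a discounted fixed point. -/
lemma exists_bellman_fixedPoint (G : MarkovGame S A B) (Φ : S → (A → B → ℝ) → ℝ)
    (hΦ : ∀ s M M' d, (∀ a b, |M a b - M' a b| ≤ d) → |Φ s M - Φ s M'| ≤ d) :
    ∃ W : S → ℝ, ∀ s, W s = Φ s (G.qFun W s) := by
  have hc : ContractingWith ⟨G.γ, G.γ_nonneg⟩ fun (W : S → ℝ) s => Φ s (G.qFun W s) := by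
    refine ⟨by exact_mod_cast G.γ_lt_one, LipschitzWith.of_dist_le_mul fun W W' => ?_⟩
    refine (dist_pi_le_iff (mul_nonneg G.γ_nonneg dist_nonneg)).2 fun s => ?_
    refine hΦ s _ _ _ fun a b => (G.abs_qFun_sub_le W W' s a b).trans
      (mul_le_mul_of_nonneg_left ?_ G.γ_nonneg)
    calc ∑ s', G.trans s a b s' * |W s' - W' s'| ≤ ∑ s', G.trans s a b s' * dist W W' :=
          Finset.sum_le_sum fun s' _ => mul_le_mul_of_nonneg_left (dist_le_pi_dist W W' s')
            (stdSimplex.zero_le _ s')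
      _ = dist W W' := by rw [← Finset.sum_mul, stdSimplex.sum_eq_one, one_mul]
  exact ⟨ContractingWith.fixedPoint _ hc, fun s => (congrFun hc.fixedPoint_isFixedPt s).symm⟩

end MarkovGame

namespace MarkovGame

variable {S A B : Type*} [Fintype S] [Fintype A] [Fintype B]

/-! ### Concentrability -/

section Concentrability

variable (G : MarkovGame S A B) (ρ : stdSimplex ℝ S)

lemma pushDist_succ (x : ℕ → S → A) (y : ℕ → S → B) (t : ℕ) (s' : S) :
    G.pushDist ρ x y (t + 1) s' =
      ∑ s, G.pushDist ρ x y t s * G.trans s (x t s) (y t s) s' := rfl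

lemma pushDist_nonneg (x : ℕ → S → A) (y : ℕ → S → B) (t : ℕ) (s : S) :
    0 ≤ G.pushDist ρ x y t s := by
  induction t generalizing s with
  | zero => exact stdSimplex.zero_le ρ s
  | succ t ih =>
    rw [pushDist_succ]
    exact Finset.sum_nonneg fun s' _ => mul_nonneg (ih s') (stdSimplex.zero_le _ s)

lemma sum_pushDist (x : ℕ → S → A) (y : ℕ → S → B) (t : ℕ) : ∑ s, G.pushDist ρ x y t s = 1 := by
  induction t with
  | zero => exact ρ.2.2
  | succ t ih =>
    simp only [pushDist_succ]
    rw [Finset.sum_comm]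
    simp only [← Finset.mul_sum, stdSimplex.sum_eq_one, mul_one, ih]

/-- The distribution at time `t` involves only the first `t` action choices, so the choice at time
`t` is free to be altered. -/
lemma pushDist_congr {x x' : ℕ → S → A} {y y' : ℕ → S → B} {t : ℕ}
    (hx : ∀ i < t, x i = x' i) (hy : ∀ i < t, y i = y' i) :
    G.pushDist ρ x y t = G.pushDist ρ x' y' t := by
  induction t with
  | zero => rfl
  | succ t ih =>
    funext s
    rw [pushDist_succ, pushDist_succ, hx t (Nat.lt_succ_self t), hy t (Nat.lt_succ_self t),
      ih (fun i hi => hx i (hi.trans (Nat.lt_succ_self t)))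
        (fun i hi => hy i (hi.trans (Nat.lt_succ_self t)))]

lemma pushDist_le_one (x : ℕ → S → A) (y : ℕ → S → B) (t : ℕ) (s : S) :
    G.pushDist ρ x y t s ≤ 1 := by
  rw [← G.sum_pushDist ρ x y t]
  exact Finset.single_le_sum (fun s _ => G.pushDist_nonneg ρ x y t s) (Finset.mem_univ s)

variable {ρ}

/-- Real suprema take a default value on unbounded sets; this bound makes those in the coefficients
genuine. -/
lemma norm_div_le (hρ : ∀ s, 0 < ρ s) {f : S → ℝ} (h0 : ∀ s, 0 ≤ f s) (h1 : ∀ s, f s ≤ 1) :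
    ‖fun s => f s / ρ s‖ ≤ ‖fun s => 1 / ρ s‖ := by
  refine (pi_norm_le_iff_of_nonneg (norm_nonneg _)).2 fun s => ?_
  refine le_trans ?_ (norm_le_pi_norm (fun s => 1 / ρ s) s)
  rw [Real.norm_of_nonneg (div_nonneg (h0 s) (hρ s).le),
    Real.norm_of_nonneg (div_nonneg zero_le_one (hρ s).le)]
  exact div_le_div_of_nonneg_right (h1 s) (hρ s).le

lemma bddAbove_concentrabilityAt (hρ : ∀ s, 0 < ρ s) (t : ℕ) :
    BddAbove (Set.range fun xy : (ℕ → S → A) × (ℕ → S → B) =>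
      ‖fun s => G.pushDist ρ xy.1 xy.2 t s / ρ s‖) := by
  refine ⟨‖fun s => 1 / ρ s‖, ?_⟩
  rintro _ ⟨xy, rfl⟩
  exact norm_div_le hρ (G.pushDist_nonneg ρ _ _ t) (G.pushDist_le_one ρ _ _ t)

variable [Nonempty A] [Nonempty B]

lemma concentrabilityAt_le_concentrability (hρ : ∀ s, 0 < ρ s) (t : ℕ) :
    G.concentrabilityAt ρ t ≤ G.concentrability ρ := by
  refine le_ciSup (f := fun t => G.concentrabilityAt ρ t) ⟨‖fun s => 1 / ρ s‖, ?_⟩ t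
  rintro _ ⟨t, rfl⟩
  exact ciSup_le fun xy =>
    norm_div_le hρ (G.pushDist_nonneg ρ _ _ t) (G.pushDist_le_one ρ _ _ t)

lemma pushDist_le (hρ : ∀ s, 0 < ρ s) (x : ℕ → S → A) (y : ℕ → S → B) (t : ℕ) (s : S) :
    G.pushDist ρ x y t s ≤ G.concentrability ρ * ρ s := by
  rw [← div_le_iff₀ (hρ s)]
  calc G.pushDist ρ x y t s / ρ s ≤ ‖fun s => G.pushDist ρ x y t s / ρ s‖ :=
        (Real.le_norm_self _).trans (norm_le_pi_norm (fun s => G.pushDist ρ x y t s / ρ s) s)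
    _ ≤ G.concentrabilityAt ρ t := le_ciSup (G.bddAbove_concentrabilityAt hρ t) (x, y)
    _ ≤ G.concentrability ρ := G.concentrabilityAt_le_concentrability hρ t

/-- At time `0` the ratio is `ρ / ρ = 1`. -/
lemma one_le_concentrability (hρ : ∀ s, 0 < ρ s) : 1 ≤ G.concentrability ρ := by
  obtain ⟨s, -⟩ := exists_pos ρ
  have h := G.pushDist_le hρ (fun _ _ => Classical.arbitrary A) (fun _ _ => Classical.arbitrary B)
    0 s
  change ρ s ≤ _ at h
  by_contra! h1
  nlinarith [mul_lt_mul_of_pos_right h1 (hρ s)]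

variable (ρ)

/-- Largest mean of `f` over the state distributions reachable from `ρ`. -/
def reachSup (f : S → ℝ) : ℝ :=
  ⨆ i : ℕ × (ℕ → S → A) × (ℕ → S → B), ∑ s, G.pushDist ρ i.2.1 i.2.2 i.1 s * f s

lemma le_reachSup (f : S → ℝ) (x : ℕ → S → A) (y : ℕ → S → B) (t : ℕ) :
    ∑ s, G.pushDist ρ x y t s * f s ≤ G.reachSup ρ f := by
  refine le_ciSup (f := fun i : ℕ × (ℕ → S → A) × (ℕ → S → B) =>
    ∑ s, G.pushDist ρ i.2.1 i.2.2 i.1 s * f s) ⟨∑ s, |f s|, ?_⟩ (t, x, y)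
  rintro _ ⟨i, rfl⟩
  refine Finset.sum_le_sum fun s _ => ?_
  calc _ ≤ G.pushDist ρ i.2.1 i.2.2 i.1 s * |f s| :=
        mul_le_mul_of_nonneg_left (le_abs_self _) (G.pushDist_nonneg ρ _ _ _ s)
    _ ≤ |f s| := mul_le_of_le_one_left (abs_nonneg _) (G.pushDist_le_one ρ _ _ _ s)

lemma reachSup_le {f : S → ℝ} {c : ℝ}
    (h : ∀ x y t, ∑ s, G.pushDist ρ x y t s * f s ≤ c) : G.reachSup ρ f ≤ c :=
  ciSup_le fun i => h i.2.1 i.2.2 i.1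

lemma reachSup_le_of_le {f : S → ℝ} {c : ℝ} (h : ∀ s, f s ≤ c) : G.reachSup ρ f ≤ c :=
  G.reachSup_le ρ fun x y t => by
    calc ∑ s, G.pushDist ρ x y t s * f s ≤ ∑ s, G.pushDist ρ x y t s * c :=
          Finset.sum_le_sum fun s _ =>
            mul_le_mul_of_nonneg_left (h s) (G.pushDist_nonneg ρ x y t s)
      _ = c := by rw [← Finset.sum_mul, sum_pushDist, one_mul]

lemma sum_le_reachSup (f : S → ℝ) : ∑ s, ρ s * f s ≤ G.reachSup ρ f :=
  G.le_reachSup ρ f (fun _ _ => Classical.arbitrary A) (fun _ _ => Classical.arbitrary B) 0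

lemma reachSup_nonneg {f : S → ℝ} (hf : ∀ s, 0 ≤ f s) : 0 ≤ G.reachSup ρ f :=
  (Finset.sum_nonneg fun s _ => mul_nonneg (stdSimplex.zero_le ρ s) (hf s)).trans
    (G.sum_le_reachSup ρ f)

/-- The exchange of a reachable mean for a `ρ`-mean. In the Lyapunov recursion it is applied to the
divergence terms only. -/
lemma sum_pushDist_mul_le (hρ : ∀ s, 0 < ρ s) {f : S → ℝ} (hf : ∀ s, 0 ≤ f s)
    (x : ℕ → S → A) (y : ℕ → S → B) (t : ℕ) :
    ∑ s, G.pushDist ρ x y t s * f s ≤ G.concentrability ρ * ∑ s, ρ s * f s := by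
  rw [Finset.mul_sum]
  refine Finset.sum_le_sum fun s _ => ?_
  rw [← mul_assoc]
  exact mul_le_mul_of_nonneg_right (G.pushDist_le hρ x y t s) (hf s)

/-- Reachable distributions are stable under one more transition. -/
lemma reachSup_next_le {f g : S → ℝ} {γ : ℝ} (hγ : 0 ≤ γ) (x : S → A) (y : S → B)
    (h : ∀ s, f s ≤ γ * ∑ s', G.trans s (x s) (y s) s' * g s') :
    G.reachSup ρ f ≤ γ * G.reachSup ρ g := by
  refine G.reachSup_le ρ fun x' y' t => ?_
  -- Playing `(x, y)` at time `t` after the given choices is again admissible.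
  have h1 := G.le_reachSup ρ g (Function.update x' t x) (Function.update y' t y) (t + 1)
  simp only [pushDist_succ, Function.update_self] at h1
  rw [← G.pushDist_congr ρ (x := x') (y := y')
    (fun i hi => (Function.update_of_ne hi.ne x x').symm)
    (fun i hi => (Function.update_of_ne hi.ne y y').symm)] at h1
  calc ∑ s, G.pushDist ρ x' y' t s * f s
      ≤ ∑ s, G.pushDist ρ x' y' t s * (γ * ∑ s', G.trans s (x s) (y s) s' * g s') :=
        Finset.sum_le_sum fun s _ =>
          mul_le_mul_of_nonneg_left (h s) (G.pushDist_nonneg ρ x' y' t s)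
    _ = γ * ∑ s', (∑ s, G.pushDist ρ x' y' t s * G.trans s (x s) (y s) s') * g s' := by
        simp only [Finset.mul_sum, Finset.sum_mul]
        rw [Finset.sum_comm]
        exact Finset.sum_congr rfl fun s' _ => Finset.sum_congr rfl fun s _ => by ring
    _ ≤ γ * G.reachSup ρ g := mul_le_mul_of_nonneg_left h1 hγ

end Concentrability

/-! ### Best responses and the mismatch coefficient -/

section Mismatch

variable (G : MarkovGame S A B) (ρ : stdSimplex ℝ S)

lemma visitation_nonneg (μ : Policy S A) (ν : Policy S B) (s : S) :
    0 ≤ G.visitation ρ μ ν s := by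
  rw [visitation_eq]
  exact Finset.sum_nonneg fun s₀ _ => mul_nonneg (stdSimplex.zero_le ρ s₀) (G.visit_nonneg μ ν s₀ s)

lemma visitation_le_one (μ : Policy S A) (ν : Policy S B) (s : S) :
    G.visitation ρ μ ν s ≤ 1 := by
  rw [visitation_eq, ← stdSimplex.sum_eq_one ρ]
  exact Finset.sum_le_sum fun s₀ _ =>
    mul_le_of_le_one_right (stdSimplex.zero_le ρ s₀) (G.visit_le_one μ ν s₀ s)

/-- At the fixed point of the optimality operator the soft response has zero residual and every
other policy a nonpositive one; the performance difference identity concludes. -/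
lemma exists_isMaxResponse [Nonempty A] {τ : ℝ} (hτ : 0 < τ) (ν : Policy S B) :
    ∃ μ, G.IsMaxResponse τ ρ μ ν := by
  obtain ⟨W, hW⟩ := G.exists_bellman_fixedPoint
    (fun s M => gameValue τ M (softResponse τ M (ν s)) (ν s)) (fun s M M' d h => by
      have h1 := abs_le.1 (abs_gameValue_sub_le τ M M' (softResponse τ M (ν s)) (ν s) d h)
      have h2 := abs_le.1 (abs_gameValue_sub_le τ M M' (softResponse τ M' (ν s)) (ν s) d h)
      have h3 := gameValue_le_softResponse hτ M (softResponse τ M' (ν s)) (ν s)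
      have h4 := gameValue_le_softResponse hτ M' (softResponse τ M (ν s)) (ν s)
      rw [abs_le]
      constructor <;> linarith [h1.1, h1.2, h2.1, h2.2])
  refine ⟨fun s => softResponse τ (G.qFun W s) (ν s), fun μ' => ?_⟩
  have h1 := G.valueAt_sub_eq τ (fun s => softResponse τ (G.qFun W s) (ν s)) ν ρ W
  simp only [← hW, sub_self, mul_zero, Finset.sum_const_zero] at h1
  have h2 := G.valueAt_sub_eq τ μ' ν ρ W
  have h3 : ∑ s, G.visitation ρ μ' ν s * (gameValue τ (G.qFun W s) (μ' s) (ν s) - W s) ≤ 0 :=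
    Finset.sum_nonpos fun s _ => mul_nonpos_of_nonneg_of_nonpos (G.visitation_nonneg ρ μ' ν s) (by
      have := gameValue_le_softResponse hτ (G.qFun W s) (μ' s) (ν s)
      rw [← hW] at this
      linarith)
  have hγ := sub_pos.2 G.γ_lt_one
  by_contra! h4
  nlinarith [mul_pos hγ (sub_pos.2 h4)]

lemma exists_isMinResponse [Nonempty B] {τ : ℝ} (hτ : 0 < τ) (μ : Policy S A) :
    ∃ ν, G.IsMinResponse τ ρ μ ν := by
  have hle : ∀ (M : A → B → ℝ) (p : stdSimplex ℝ A) (q : stdSimplex ℝ B),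
      gameValue τ M p (softResponse τ (fun b a => -M a b) p) ≤ gameValue τ M p q := fun M p q => by
    have := gameValue_le_softResponse hτ (fun b a => -M a b) q p
    rwa [gameValue_swap, gameValue_swap, neg_le_neg_iff] at this
  obtain ⟨W, hW⟩ := G.exists_bellman_fixedPoint
    (fun s M => gameValue τ M (μ s) (softResponse τ (fun b a => -M a b) (μ s)))
    (fun s M M' d h => by
      have h1 := abs_le.1 (abs_gameValue_sub_le τ M M' (μ s)
        (softResponse τ (fun b a => -M a b) (μ s)) d h)
      have h2 := abs_le.1 (abs_gameValue_sub_le τ M M' (μ s)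
        (softResponse τ (fun b a => -M' a b) (μ s)) d h)
      have h3 := hle M (μ s) (softResponse τ (fun b a => -M' a b) (μ s))
      have h4 := hle M' (μ s) (softResponse τ (fun b a => -M a b) (μ s))
      rw [abs_le]
      constructor <;> linarith [h1.1, h1.2, h2.1, h2.2])
  refine ⟨fun s => softResponse τ (fun b a => -G.qFun W s a b) (μ s), fun ν' => ?_⟩
  have h1 := G.valueAt_sub_eq τ μ (fun s => softResponse τ (fun b a => -G.qFun W s a b) (μ s)) ρ W
  simp only [← hW, sub_self, mul_zero, Finset.sum_const_zero] at h1
  have h2 := G.valueAt_sub_eq τ μ ν' ρ W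
  have h3 : 0 ≤ ∑ s, G.visitation ρ μ ν' s * (gameValue τ (G.qFun W s) (μ s) (ν' s) - W s) :=
    Finset.sum_nonneg fun s _ => mul_nonneg (G.visitation_nonneg ρ μ ν' s) (by
      have := hle (G.qFun W s) (μ s) (ν' s)
      rw [← hW] at this
      linarith)
  have hγ := sub_pos.2 G.γ_lt_one
  by_contra! h4
  nlinarith [mul_pos hγ (sub_pos.2 h4)]

variable {ρ}

lemma visitation_le_norm_mul (hρ : ∀ s, 0 < ρ s) (μ : Policy S A) (ν : Policy S B) (s : S) :
    G.visitation ρ μ ν s ≤ ‖fun s => G.visitation ρ μ ν s / ρ s‖ * ρ s := by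
  rw [← div_le_iff₀ (hρ s)]
  exact (Real.le_norm_self _).trans (norm_le_pi_norm (fun s => G.visitation ρ μ ν s / ρ s) s)

lemma visitation_le_of_isMaxResponse (hρ : ∀ s, 0 < ρ s) {τ : ℝ} {μ : Policy S A}
    {ν : Policy S B} (h : G.IsMaxResponse τ ρ μ ν) (s : S) :
    G.visitation ρ μ ν s ≤ G.mismatch τ ρ * ρ s := by
  refine (G.visitation_le_norm_mul hρ μ ν s).trans (mul_le_mul_of_nonneg_right ?_ (hρ s).le)
  have hb : BddAbove {c : ℝ | ∃ (μ : Policy S A) (ν : Policy S B), G.IsMaxResponse τ ρ μ ν ∧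
      c = ‖fun s => G.visitation ρ μ ν s / ρ s‖} := by
    refine ⟨‖fun s => 1 / ρ s‖, ?_⟩
    rintro _ ⟨μ, ν, -, rfl⟩
    exact norm_div_le hρ (G.visitation_nonneg ρ μ ν) (G.visitation_le_one ρ μ ν)
  exact (le_csSup hb ⟨μ, ν, h, rfl⟩).trans (le_max_right _ _)

lemma visitation_le_of_isMinResponse (hρ : ∀ s, 0 < ρ s) {τ : ℝ} {μ : Policy S A}
    {ν : Policy S B} (h : G.IsMinResponse τ ρ μ ν) (s : S) :
    G.visitation ρ μ ν s ≤ G.mismatch τ ρ * ρ s := by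
  refine (G.visitation_le_norm_mul hρ μ ν s).trans (mul_le_mul_of_nonneg_right ?_ (hρ s).le)
  have hb : BddAbove {c : ℝ | ∃ (μ : Policy S A) (ν : Policy S B), G.IsMinResponse τ ρ μ ν ∧
      c = ‖fun s => G.visitation ρ μ ν s / ρ s‖} := by
    refine ⟨‖fun s => 1 / ρ s‖, ?_⟩
    rintro _ ⟨μ, ν, -, rfl⟩
    exact norm_div_le hρ (G.visitation_nonneg ρ μ ν) (G.visitation_le_one ρ μ ν)
  exact (le_csSup hb ⟨μ, ν, h, rfl⟩).trans (le_max_left _ _)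

/-- Stagewise gaps control the duality gap, from any initial state. -/
lemma value_gap_le (hρ : ∀ s, 0 < ρ s) {τ : ℝ} (W : S → ℝ) (μ₁ μ₂ : Policy S A)
    (ν₁ ν₂ : Policy S B) {g₁ g₂ : S → ℝ} (hg₁ : ∀ s, 0 ≤ g₁ s) (hg₂ : ∀ s, 0 ≤ g₂ s)
    (h₁ : ∀ (μ : Policy S A) s, gameValue τ (G.qFun W s) (μ s) (ν₁ s) - W s ≤ g₁ s)
    (h₂ : ∀ (ν : Policy S B) s, W s - gameValue τ (G.qFun W s) (μ₁ s) (ν s) ≤ g₂ s) (s : S) :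
    (1 - G.γ) * (G.value τ μ₂ ν₁ s - G.value τ μ₁ ν₂ s) ≤
      ‖fun s => 1 / ρ s‖ * ∑ s, ρ s * (g₁ s + g₂ s) := by
  have e1 := G.value_sub_eq τ μ₂ ν₁ W s
  have e2 := G.value_sub_eq τ μ₁ ν₂ W s
  -- A normalized visitation weight is at most one, hence at most `‖1/ρ‖ ρ`.
  have hv : ∀ (μ : Policy S A) (ν : Policy S B) s', G.visit μ ν s s' ≤ ‖fun s => 1 / ρ s‖ * ρ s' :=
    fun μ ν s' => by
      refine (G.visit_le_one μ ν s s').trans ?_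
      rw [← div_le_iff₀ (hρ s')]
      exact (Real.le_norm_self _).trans (norm_le_pi_norm (fun s => 1 / ρ s) s')
  have i1 : ∑ s', G.visit μ₂ ν₁ s s' * (gameValue τ (G.qFun W s') (μ₂ s') (ν₁ s') - W s') ≤
      ∑ s', ‖fun s => 1 / ρ s‖ * (ρ s' * g₁ s') := Finset.sum_le_sum fun s' _ => by
    rw [← mul_assoc]
    exact (mul_le_mul_of_nonneg_left (h₁ μ₂ s') (G.visit_nonneg _ _ s s')).trans
      (mul_le_mul_of_nonneg_right (hv _ _ s') (hg₁ s'))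
  have i2 : -∑ s', G.visit μ₁ ν₂ s s' * (gameValue τ (G.qFun W s') (μ₁ s') (ν₂ s') - W s') ≤
      ∑ s', ‖fun s => 1 / ρ s‖ * (ρ s' * g₂ s') := by
    rw [← Finset.sum_neg_distrib]
    refine Finset.sum_le_sum fun s' _ => ?_
    rw [← mul_assoc, ← mul_neg, neg_sub]
    exact (mul_le_mul_of_nonneg_left (h₂ ν₂ s') (G.visit_nonneg _ _ s s')).trans
      (mul_le_mul_of_nonneg_right (hv _ _ s') (hg₂ s'))
  simp only [mul_add, Finset.sum_add_distrib]
  simp only [← Finset.mul_sum] at i1 i2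
  linarith

/-- Stagewise gaps control the duality gap from `ρ`, with the mismatch coefficient. -/
lemma valueAt_gap_le [Nonempty A] [Nonempty B] (hρ : ∀ s, 0 < ρ s) {τ : ℝ} (hτ : 0 < τ)
    (W : S → ℝ) (μ₁ μ₂ : Policy S A)
    (ν₁ ν₂ : Policy S B) {g₁ g₂ : S → ℝ} (hg₁ : ∀ s, 0 ≤ g₁ s) (hg₂ : ∀ s, 0 ≤ g₂ s)
    (h₁ : ∀ (μ : Policy S A) s, gameValue τ (G.qFun W s) (μ s) (ν₁ s) - W s ≤ g₁ s)
    (h₂ : ∀ (ν : Policy S B) s, W s - gameValue τ (G.qFun W s) (μ₁ s) (ν s) ≤ g₂ s) :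
    (1 - G.γ) * (G.valueAt τ μ₂ ν₁ ρ - G.valueAt τ μ₁ ν₂ ρ) ≤
      G.mismatch τ ρ * ∑ s, ρ s * (g₁ s + g₂ s) := by
  -- Passing to best responses only widens the gap, and their visitation is what the mismatch
  -- coefficient controls.
  obtain ⟨μ', hμ'⟩ := G.exists_isMaxResponse ρ hτ ν₁
  obtain ⟨ν', hν'⟩ := G.exists_isMinResponse ρ hτ μ₁
  have hle : G.valueAt τ μ₂ ν₁ ρ - G.valueAt τ μ₁ ν₂ ρ ≤
      G.valueAt τ μ' ν₁ ρ - G.valueAt τ μ₁ ν' ρ := sub_le_sub (hμ' μ₂) (hν' ν₂)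
  have e1 := G.valueAt_sub_eq τ μ' ν₁ ρ W
  have e2 := G.valueAt_sub_eq τ μ₁ ν' ρ W
  have i1 : ∑ s, G.visitation ρ μ' ν₁ s * (gameValue τ (G.qFun W s) (μ' s) (ν₁ s) - W s) ≤
      ∑ s, G.mismatch τ ρ * (ρ s * g₁ s) := Finset.sum_le_sum fun s _ => by
    rw [← mul_assoc]
    exact (mul_le_mul_of_nonneg_left (h₁ μ' s) (G.visitation_nonneg ρ _ _ s)).trans
      (mul_le_mul_of_nonneg_right (G.visitation_le_of_isMaxResponse hρ hμ' s) (hg₁ s))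
  have i2 : -∑ s, G.visitation ρ μ₁ ν' s * (gameValue τ (G.qFun W s) (μ₁ s) (ν' s) - W s) ≤
      ∑ s, G.mismatch τ ρ * (ρ s * g₂ s) := by
    rw [← Finset.sum_neg_distrib]
    refine Finset.sum_le_sum fun s _ => ?_
    rw [← mul_assoc, ← mul_neg, neg_sub]
    exact (mul_le_mul_of_nonneg_left (h₂ ν' s) (G.visitation_nonneg ρ _ _ s)).trans
      (mul_le_mul_of_nonneg_right (G.visitation_le_of_isMinResponse hρ hν' s) (hg₂ s))
  have h3 := mul_le_mul_of_nonneg_left hle (sub_pos.2 G.γ_lt_one).le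
  simp only [mul_add, Finset.sum_add_distrib]
  simp only [← Finset.mul_sum] at i1 i2
  linarith

end Mismatch

end MarkovGame

/-! ### The Lyapunov recursion -/

/-- One step of the Lyapunov recursion; `g` stands for `1 - γ`. -/
lemma lyapunov_step_le {η τ g C k k' a a' b' e' u u' q q' : ℝ} (hη : 0 < η) (hτ : 0 < τ)
    (hτ1 : τ ≤ 1) (hg : 0 < g) (hg1 : g ≤ 1) (hC : 1 ≤ C) (hηC : 32000 * (η * C) ≤ g ^ 3)
    (hk : 0 ≤ k) (ha : 0 ≤ a) (ha' : 0 ≤ a') (hb' : 0 ≤ b') (hu : 0 ≤ u) (hq : 0 ≤ q)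
    (h1 : k' + a' + (1 - η * τ) * b' + η * τ * e' ≤ (1 - η * τ) * k + 2 * η * q' +
      8 * η ^ 2 * (2 / g) * (q + q') + 2 * η * (2 / g) * (2 * a' + a + b'))
    (h2 : u' ≤ (1 - η * τ) * u + η * τ * q' + η * τ * (4 * η * (2 / g)) * (q + q') +
      2 * (η * τ) * (2 / g) * (C * (2 * a' + a + b')))
    (h3 : q' ≤ (1 - g) * u) :
    k' + a' / 2 + 4 / (g * τ) * u' + η / 2 * q' + η * τ * e' ≤
      (1 - g * (η * τ) / 4) * (k + a / 2 + 4 / (g * τ) * u + η / 2 * q) := by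
  have hηC' : η ≤ η * C := le_mul_of_one_le_right hη.le hC
  have hg2 : g ^ 2 ≤ 1 := pow_le_one₀ hg.le hg1
  have hg3 : g ^ 3 ≤ g ^ 2 := pow_le_pow_of_le_one hg.le hg1 (by norm_num)
  have hη1 : 32000 * η ≤ 1 := by linarith
  have hα : η * τ ≤ 1 / 32000 := by linarith [mul_le_of_le_one_right hη.le hτ1]
  have hα0 : 0 < η * τ := mul_pos hη hτ
  -- small quantities
  obtain ⟨x, hx⟩ : ∃ x, x = η / g ^ 2 := ⟨_, rfl⟩
  obtain ⟨y, hy⟩ : ∃ y, y = η * C / g ^ 2 := ⟨_, rfl⟩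
  have hx0 : 0 ≤ x := by rw [hx]; positivity
  have hx1 : 32000 * x ≤ 1 := by
    rw [hx, ← mul_div_assoc, div_le_one (by positivity)]
    linarith
  have hy0 : 0 ≤ y := by rw [hy]; positivity
  have hy1 : 32000 * y ≤ 1 := by
    rw [hy, ← mul_div_assoc, div_le_one (by positivity)]
    linarith
  have hxy : η / g ≤ x := by
    rw [hx]
    exact div_le_div_of_nonneg_left hη.le (by positivity) (by nlinarith)
  have hηg : 0 ≤ η / g := by positivity
  -- The weight `4 / (g τ)` removes `τ` from the value recursion; the concentrability term becomes
  -- `16 y`.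
  have hKu : 4 / (g * τ) * u' ≤ 4 / (g * τ) * ((1 - η * τ) * u) + 4 * (η / g) * q' +
      32 * η * x * (q + q') + 16 * y * (2 * a' + a + b') := by
    have h4 := mul_le_mul_of_nonneg_left h2 (by positivity : 0 ≤ 4 / (g * τ))
    refine h4.trans (le_of_eq ?_)
    rw [hx, hy]
    field_simp
    ring
  have hku : 4 / (g * τ) * ((1 - η * τ) * u) = 4 / (g * τ) * u - 4 * (η / g) * u := by
    field_simp
  have h1' : k' + a' + (1 - η * τ) * b' + η * τ * e' ≤ (1 - η * τ) * k + 2 * η * q' +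
      16 * η * (η / g) * (q + q') + 4 * (η / g) * (2 * a' + a + b') := by
    refine h1.trans (le_of_eq ?_)
    field_simp
    ring
  have hrhs : (1 - g * (η * τ) / 4) * (k + a / 2 + 4 / (g * τ) * u + η / 2 * q) =
      k - g * (η * τ) / 4 * k + (1 - g * (η * τ) / 4) * (a / 2) + 4 / (g * τ) * u - η * u +
        (1 - g * (η * τ) / 4) * (η / 2 * q) := by
    field_simp
    ring
  have hS : 0 ≤ 2 * a' + a + b' := by linarith
  -- All divergence errors carry a coefficient below `1/100`, absorbed by half of `a'`, by `b'` and
  -- by `a / 2`.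
  have hs1 : 4 * (η / g) * (2 * a' + a + b') + 16 * y * (2 * a' + a + b') ≤
      1 / 100 * (2 * a' + a + b') := by
    rw [← add_mul]
    exact mul_le_mul_of_nonneg_right (by linarith) hS
  have hgα : g * (η * τ) / 4 ≤ 1 / 100 := by
    have := mul_le_of_le_one_left hα0.le hg1
    linarith
  have hgα0 : 0 ≤ g * (η * τ) / 4 := by positivity
  have hb1 : 99 / 100 * b' ≤ (1 - η * τ) * b' := mul_le_mul_of_nonneg_right (by linarith) hb'
  have hk1 : (1 - η * τ) * k ≤ k - g * (η * τ) / 4 * k := by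
    have h5 := mul_le_of_le_one_left hα0.le hg1
    have h6 : g * (η * τ) / 4 ≤ η * τ := by linarith
    linarith [mul_le_mul_of_nonneg_right h6 hk]
  have ha1 : 99 / 100 * (a / 2) ≤ (1 - g * (η * τ) / 4) * (a / 2) :=
    mul_le_mul_of_nonneg_right (by linarith) (by linarith)
  have hηq : 0 ≤ η * q := mul_nonneg hη.le hq
  have hq1 : 99 / 100 * (η / 2 * q) ≤ (1 - g * (η * τ) / 4) * (η / 2 * q) :=
    mul_le_mul_of_nonneg_right (by linarith) (by linarith)
  have hc0 : 0 ≤ 5 / 2 * η + 4 * (η / g) + 1 / 100 * η := by positivity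
  have hqq : (16 * η * (η / g) + 32 * η * x) * q ≤ 1 / 100 * (η * q) := by
    rw [show (16 * η * (η / g) + 32 * η * x) * q = (16 * (η / g) + 32 * x) * (η * q) by ring]
    exact mul_le_mul_of_nonneg_right (by linarith) hηq
  have hcoef : 16 * η * (η / g) + 32 * η * x ≤ 1 / 100 * η := by
    rw [show 16 * η * (η / g) + 32 * η * x = (16 * (η / g) + 32 * x) * η by ring]
    exact mul_le_mul_of_nonneg_right (by linarith) hη.le
  have hcoef0 : 0 ≤ 2 * η + η / 2 + 4 * (η / g) + (16 * η * (η / g) + 32 * η * x) := by positivity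
  have hq' : (2 * η + η / 2 + 4 * (η / g) + (16 * η * (η / g) + 32 * η * x)) * q' ≤
      (5 / 2 * η + 4 * (η / g) + 1 / 100 * η) * ((1 - g) * u) := by
    refine (mul_le_mul_of_nonneg_left h3 hcoef0).trans (mul_le_mul_of_nonneg_right ?_ ?_)
    · linarith
    · exact mul_nonneg (by linarith) hu
  -- As `q' ≤ (1 - g) u`, the value recursion leaves a surplus `4 η u`; it pays for the other `q'`
  -- terms, at most `2.51 η u`, and for the `η u` of the claimed rate.
  have hu1 : (5 / 2 * η + 4 * (η / g) + 1 / 100 * η) * ((1 - g) * u) ≤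
      4 * (η / g) * u - η * u := by
    have h5 : (5 / 2 * η + 4 * (η / g) + 1 / 100 * η) * ((1 - g) * u) =
        4 * (η / g) * u - 4 * η * u + 251 / 100 * η * u - 251 / 100 * (g * (η * u)) := by
      field_simp
      ring
    have h6 : 0 ≤ η * u := mul_nonneg hη.le hu
    have h7 : 0 ≤ g * (η * u) := mul_nonneg hg.le h6
    rw [h5]
    linarith
  rw [hrhs]
  linarith

lemma sum_mul_linear_comb {S : Type*} [Fintype S] (χ f₁ f₂ f₃ f₄ : S → ℝ) (c₁ c₂ c₃ c₄ : ℝ) :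
    ∑ s, χ s * (c₁ * f₁ s + c₂ * f₂ s + c₃ * f₃ s + c₄ * f₄ s) =
      c₁ * ∑ s, χ s * f₁ s + c₂ * ∑ s, χ s * f₂ s + c₃ * ∑ s, χ s * f₃ s +
        c₄ * ∑ s, χ s * f₄ s := by
  simp only [Finset.mul_sum, ← Finset.sum_add_distrib]
  exact Finset.sum_congr rfl fun s _ => by ring

/-- Entrywise sup distance of two matrices. -/
def matDist {A B : Type*} (M M' : A → B → ℝ) : ℝ :=
  ⨆ ab : A × B, |M ab.1 ab.2 - M' ab.1 ab.2|

section MatDist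

variable {A B : Type*} [Fintype A] [Fintype B]

lemma abs_sub_le_matDist (M M' : A → B → ℝ) (a : A) (b : B) : |M a b - M' a b| ≤ matDist M M' :=
  le_ciSup (f := fun ab : A × B => |M ab.1 ab.2 - M' ab.1 ab.2|) (Set.finite_range _).bddAbove (a, b)

lemma exists_eq_matDist [Nonempty A] [Nonempty B] (M M' : A → B → ℝ) :
    ∃ a b, |M a b - M' a b| = matDist M M' := by
  obtain ⟨ab, h⟩ := exists_eq_ciSup_of_finite (f := fun ab : A × B => |M ab.1 ab.2 - M' ab.1 ab.2|)
  exact ⟨ab.1, ab.2, h⟩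

lemma matDist_nonneg (M M' : A → B → ℝ) : 0 ≤ matDist M M' :=
  Real.iSup_nonneg fun _ => abs_nonneg _

end MatDist

/-! ### Regularized Nash equilibrium of the Markov game -/

namespace MarkovGame

variable {S A B : Type*} [Fintype S] [Fintype A] [Fintype B]

lemma abs_qFun_le (G : MarkovGame S A B) {W : S → ℝ} {m : ℝ} (h : ∀ s, |W s| ≤ m) (s : S) (a : A)
    (b : B) : |G.qFun W s a b| ≤ 1 + G.γ * m := by
  have h1 := abs_sum_mul_simplex_le (G.trans s a b) W m h
  simp_rw [mul_comm (W _)] at h1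
  have h2 := G.reward_mem s a b
  have h3 := mul_le_mul_of_nonneg_left h1 G.γ_nonneg
  rw [qFun]
  refine (abs_add_le _ _).trans (add_le_add ?_ ?_)
  · rw [abs_of_nonneg h2.1]
    exact h2.2
  · rwa [abs_mul, abs_of_nonneg G.γ_nonneg]

/-- The bound `2 / (1 - γ)` reproduces itself when a reward and an entropy term, each at most one,
are added to a discounted value. -/
lemma one_add_mul_two_div (G : MarkovGame S A B) :
    1 + G.γ * (2 / (1 - G.γ)) + 1 = 2 / (1 - G.γ) := by
  have := (sub_pos.2 G.γ_lt_one).ne'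
  field_simp
  ring

/-- Existence of a regularized Nash equilibrium, with the standard bound on its value. -/
lemma exists_equilibrium [Nonempty A] [Nonempty B] (G : MarkovGame S A B) {τ : ℝ} (hτ : 0 ≤ τ)
    (hlog : τ * (Real.log (Fintype.card A) + Real.log (Fintype.card B)) ≤ 1) :
    ∃ (W : S → ℝ) (μ : Policy S A) (ν : Policy S B),
      (∀ s, IsEquilibrium τ (G.qFun W s) (μ s) (ν s)) ∧
      (∀ s, W s = gameValue τ (G.qFun W s) (μ s) (ν s)) ∧ ∀ s, |W s| ≤ 2 / (1 - G.γ) := by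
  -- Any choice of stage equilibria serves: the equilibrium values are nonexpansive in the matrix
  -- whatever the choice.
  choose p q hpq using fun M : A → B → ℝ => exists_isEquilibrium hτ M
  obtain ⟨W, hW⟩ := G.exists_bellman_fixedPoint (fun _ M => gameValue τ M (p M) (q M))
    fun _ M M' d h => (hpq M).abs_sub_le (hpq M') h
  refine ⟨W, fun s => p (G.qFun W s), fun s => q (G.qFun W s), fun s => hpq _, hW, ?_⟩
  have hγ := sub_pos.2 G.γ_lt_one
  have h1 : ∀ s, |W s| ≤ 1 + G.γ * ‖W‖ + 1 := fun s => by
    have h2 := abs_gameValue_le τ hτ (G.qFun W s) (p (G.qFun W s)) (q (G.qFun W s)) _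
      (G.abs_qFun_le (fun s' => norm_le_pi_norm W s') s)
    rw [← hW] at h2
    linarith
  have h3 : ‖W‖ ≤ 1 + G.γ * ‖W‖ + 1 :=
    (pi_norm_le_iff_of_nonneg (by
      have := mul_nonneg G.γ_nonneg (norm_nonneg W)
      linarith)).2 h1
  have h4 : ‖W‖ ≤ 2 / (1 - G.γ) := by
    rw [le_div_iff₀ hγ]
    linarith
  exact fun s => (norm_le_pi_norm W s).trans h4

end MarkovGame

namespace Iterate

open MarkovGame

variable {S A B : Type*} [Fintype S] [Fintype A] [Fintype B] [Nonempty A] [Nonempty B]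

/-! ### Invariants of the algorithm -/

section Invariants

variable (G : MarkovGame S A B) (η τ : ℝ) (α : ℕ → ℝ)

lemma run_pos (t : ℕ) (s : S) : (∀ a, 0 < (run G η τ α t).μ s a) ∧
    (∀ b, 0 < (run G η τ α t).ν s b) ∧ (∀ a, 0 < (run G η τ α t).μbar s a) ∧
    ∀ b, 0 < (run G η τ α t).νbar s b := by
  induction t with
  | zero => exact ⟨barycenter_pos, barycenter_pos, barycenter_pos, barycenter_pos⟩
  | succ t ih =>
    exact ⟨expUpdate_pos _ _ _ ih.1 _, expUpdate_pos _ _ _ ih.2.1 _,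
      expUpdate_pos _ _ _ ih.1 _, expUpdate_pos _ _ _ ih.2.1 _⟩

lemma run_Q_succ (t : ℕ) : (run G η τ α (t + 1)).Q = G.qFun (run G η τ α t).V := rfl

lemma run_V_succ (t : ℕ) (s : S) : (run G η τ α (t + 1)).V s =
    (1 - α (t + 1)) * (run G η τ α t).V s + α (t + 1) * gameValue τ ((run G η τ α (t + 1)).Q s)
      ((run G η τ α (t + 1)).μbar s) ((run G η τ α (t + 1)).νbar s) := rfl

lemma run_abs_V_zero_le (hτ : 0 ≤ τ)
    (hlog : τ * (Real.log (Fintype.card A) + Real.log (Fintype.card B)) ≤ 1) (s : S) :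
    |(run G η τ α 0).V s| ≤ 1 := by
  change |τ * (Real.log (Fintype.card A) - Real.log (Fintype.card B))| ≤ 1
  have h1 : 0 ≤ τ * Real.log (Fintype.card A) := mul_nonneg hτ (Real.log_natCast_nonneg _)
  have h2 : 0 ≤ τ * Real.log (Fintype.card B) := mul_nonneg hτ (Real.log_natCast_nonneg _)
  rw [abs_le]
  constructor <;> linarith

lemma run_abs_V_le (hτ : 0 ≤ τ)
    (hlog : τ * (Real.log (Fintype.card A) + Real.log (Fintype.card B)) ≤ 1)
    (hα0 : ∀ t, 0 ≤ α (t + 1)) (hα1 : ∀ t, α (t + 1) ≤ 1) (t : ℕ) (s : S) :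
    |(run G η τ α t).V s| ≤ 2 / (1 - G.γ) := by
  have hγ := sub_pos.2 G.γ_lt_one
  induction t generalizing s with
  | zero =>
    refine (run_abs_V_zero_le G η τ α hτ hlog s).trans ?_
    rw [le_div_iff₀ hγ]
    linarith [G.γ_nonneg]
  | succ t ih =>
    have h1 := abs_gameValue_le τ hτ ((run G η τ α (t + 1)).Q s)
      ((run G η τ α (t + 1)).μbar s) ((run G η τ α (t + 1)).νbar s) _ (G.abs_qFun_le ih s)
    have h2 := G.one_add_mul_two_div
    rw [run_V_succ]
    refine (abs_add_le _ _).trans ?_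
    rw [abs_mul, abs_mul, abs_of_nonneg (hα0 t), abs_of_nonneg (sub_nonneg.2 (hα1 t))]
    have h3 := mul_le_mul_of_nonneg_left (ih s) (sub_nonneg.2 (hα1 t))
    have h4 := mul_le_mul_of_nonneg_left (h1.trans (by linarith :
      1 + G.γ * (2 / (1 - G.γ)) + τ * (Real.log (Fintype.card A) + Real.log (Fintype.card B)) ≤
        2 / (1 - G.γ))) (hα0 t)
    linarith

lemma run_abs_Q_le (hτ : 0 ≤ τ)
    (hlog : τ * (Real.log (Fintype.card A) + Real.log (Fintype.card B)) ≤ 1)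
    (hα0 : ∀ t, 0 ≤ α (t + 1)) (hα1 : ∀ t, α (t + 1) ≤ 1) (t : ℕ) (s : S) (a : A) (b : B) :
    |(run G η τ α t).Q s a b| ≤ 2 / (1 - G.γ) := by
  have hγ := sub_pos.2 G.γ_lt_one
  cases t with
  | zero =>
    change |(0 : ℝ)| ≤ _
    rw [abs_zero]
    positivity
  | succ t =>
    have h2 := G.one_add_mul_two_div
    have := G.abs_qFun_le (run_abs_V_le G η τ α hτ hlog hα0 hα1 t) s a b
    rw [run_Q_succ]
    linarith

end Invariants

/-! ### Error quantities -/

section Errors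

variable (z z' : Iterate S A B) (τ : ℝ) (Q₀ : S → A → B → ℝ) (W : S → ℝ) (μ₀ : Policy S A)
  (ν₀ : Policy S B) (s : S)

/-- Relative entropy from the iterate to the equilibrium. -/
def eqDiv : ℝ := relEntropy (μ₀ s) (z.μ s) + relEntropy (ν₀ s) (z.ν s)

/-- Relative entropy from the prediction to the iterate. -/
def predDiv : ℝ := relEntropy (z.μ s) (z.μbar s) + relEntropy (z.ν s) (z.νbar s)

/-- Relative entropy from an iterate to the next prediction. -/
def moveDiv : ℝ := relEntropy (z'.μbar s) (z.μ s) + relEntropy (z'.νbar s) (z.ν s)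

/-- Relative entropy from the equilibrium to the prediction. -/
def barDiv : ℝ := relEntropy (z.μbar s) (μ₀ s) + relEntropy (z.νbar s) (ν₀ s)

/-- Error of the state-action values. -/
def qErr : ℝ := matDist (z.Q s) (Q₀ s)

/-- Potential that dominates the error of the state values. -/
def vErr : ℝ :=
  max (W s - z.V s + τ * relEntropy (μ₀ s) (z.μ s)) (z.V s - W s + τ * relEntropy (ν₀ s) (z.ν s))

/-- The divergences are nonnegative, so the two arguments of the maximum dominate `W - V` and `V -
W`. -/
lemma abs_sub_le_vErr (hτ : 0 ≤ τ) (hμ : ∀ a, 0 < z.μ s a) (hν : ∀ b, 0 < z.ν s b) :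
    |z.V s - W s| ≤ z.vErr τ W μ₀ ν₀ s := by
  have h1 := mul_nonneg hτ (relEntropy_nonneg (μ₀ s) (z.μ s) hμ)
  have h2 := mul_nonneg hτ (relEntropy_nonneg (ν₀ s) (z.ν s) hν)
  have h3 := le_max_left (W s - z.V s + τ * relEntropy (μ₀ s) (z.μ s))
    (z.V s - W s + τ * relEntropy (ν₀ s) (z.ν s))
  have h4 := le_max_right (W s - z.V s + τ * relEntropy (μ₀ s) (z.μ s))
    (z.V s - W s + τ * relEntropy (ν₀ s) (z.ν s))
  rw [vErr, abs_le]
  constructor <;> linarith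

end Errors

/-! ### One-step inequality for the value potential -/

section Recursion

variable (G : MarkovGame S A B) {η τ : ℝ} {α : ℕ → ℝ} {W : S → ℝ} {μ₀ : Policy S A}
  {ν₀ : Policy S B}

/-- At each state the algorithm plays an optimistic step for the equilibrium stage game, the `Q`
errors being the accuracies of the matrices. -/
lemma isOptimisticStep_run (hτ : 0 ≤ τ)
    (hlog : τ * (Real.log (Fintype.card A) + Real.log (Fintype.card B)) ≤ 1)
    (hα0 : ∀ t, 0 ≤ α (t + 1)) (hα1 : ∀ t, α (t + 1) ≤ 1)
    (heq : ∀ s, IsEquilibrium τ (G.qFun W s) (μ₀ s) (ν₀ s)) (t : ℕ) (s : S) :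
    IsOptimisticStep η τ (2 / (1 - G.γ)) ((run G η τ α t).qErr (G.qFun W) s)
      ((run G η τ α (t + 1)).qErr (G.qFun W) s)
      ((run G η τ α t).Q s) ((run G η τ α (t + 1)).Q s) (G.qFun W s)
      ((run G η τ α t).μ s) ((run G η τ α t).μbar s) ((run G η τ α (t + 1)).μ s)
      ((run G η τ α (t + 1)).μbar s) (μ₀ s)
      ((run G η τ α t).ν s) ((run G η τ α t).νbar s) ((run G η τ α (t + 1)).ν s)
      ((run G η τ α (t + 1)).νbar s) (ν₀ s) where
  pos_left := (run_pos G η τ α t s).1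
  pos_right := (run_pos G η τ α t s).2.1
  pos_left_bar := (run_pos G η τ α t s).2.2.1
  pos_right_bar := (run_pos G η τ α t s).2.2.2
  bar_left := rfl
  bar_right := by
    simp only [neg_mul, Finset.sum_neg_distrib]
    rfl
  left := rfl
  right := by
    simp only [neg_mul, Finset.sum_neg_distrib]
    rfl
  bound := run_abs_Q_le G η τ α hτ hlog hα0 hα1 t s
  bound' := run_abs_Q_le G η τ α hτ hlog hα0 hα1 (t + 1) s
  close := abs_sub_le_matDist _ _
  close' := abs_sub_le_matDist _ _
  equilibrium := heq s

/-- One step of the state-value potential. -/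
lemma vErr_succ_le (hη : 0 < η) (hτ : 0 < τ)
    (hlog : τ * (Real.log (Fintype.card A) + Real.log (Fintype.card B)) ≤ 1)
    (hα : ∀ t, α (t + 1) = η * τ) (hητ : η * τ ≤ 1)
    (heq : ∀ s, IsEquilibrium τ (G.qFun W s) (μ₀ s) (ν₀ s))
    (hW : ∀ s, W s = gameValue τ (G.qFun W s) (μ₀ s) (ν₀ s)) (t : ℕ) (s : S) :
    (run G η τ α (t + 1)).vErr τ W μ₀ ν₀ s ≤
      (1 - η * τ) * (run G η τ α t).vErr τ W μ₀ ν₀ s +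
      (η * τ + η * τ * (4 * η * (2 / (1 - G.γ)))) *
        (run G η τ α (t + 1)).qErr (G.qFun W) s +
      η * τ * (4 * η * (2 / (1 - G.γ))) * (run G η τ α t).qErr (G.qFun W) s +
      2 * (η * τ) * (2 / (1 - G.γ)) * (2 * (run G η τ α (t + 1)).predDiv s +
        (run G η τ α t).predDiv s + (run G η τ α t).moveDiv (run G η τ α (t + 1)) s) := by
  have hα0 : ∀ t, 0 ≤ α (t + 1) := fun t => by rw [hα]; positivity
  have hα1 : ∀ t, α (t + 1) ≤ 1 := fun t => by rwa [hα]
  have hγ := sub_pos.2 G.γ_lt_one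
  have h := isOptimisticStep_run G (η := η) hτ.le hlog hα0 hα1 heq t s
  -- Multiplied by `τ`, the regret bound has the weight `η τ` of the value update, and its
  -- divergences contract by the same `1 - η τ` as `V`; so value error and divergence merge into the
  -- potential.
  have h1 := mul_le_mul_of_nonneg_left (h.regret_le hη.le hητ) hτ.le
  have h2 := mul_le_mul_of_nonneg_left (h.swap.regret_le hη.le hητ) hτ.le
  rw [gameValue_swap, gameValue_swap] at h2
  have n1 := relEntropy_nonneg ((run G η τ α (t + 1)).μ s) _ h.pos_left_bar'
  have n2 := relEntropy_nonneg ((run G η τ α (t + 1)).ν s) _ h.swap.pos_left_bar'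
  have n3 := relEntropy_nonneg ((run G η τ α t).μ s) _ h.pos_left_bar
  have n4 := relEntropy_nonneg ((run G η τ α t).ν s) _ h.pos_right_bar
  have n5 := relEntropy_nonneg ((run G η τ α (t + 1)).μbar s) _ h.pos_left
  have n6 := relEntropy_nonneg ((run G η τ α (t + 1)).νbar s) _ h.pos_right
  have hc : 0 ≤ 2 * (η * τ) * (2 / (1 - G.γ)) := by positivity
  have hm : 0 ≤ 1 - η * τ := by linarith
  have m1 := mul_le_mul_of_nonneg_left (le_max_left
    (W s - (run G η τ α t).V s + τ * relEntropy (μ₀ s) ((run G η τ α t).μ s))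
    ((run G η τ α t).V s - W s + τ * relEntropy (ν₀ s) ((run G η τ α t).ν s))) hm
  have m2 := mul_le_mul_of_nonneg_left (le_max_right
    (W s - (run G η τ α t).V s + τ * relEntropy (μ₀ s) ((run G η τ α t).μ s))
    ((run G η τ α t).V s - W s + τ * relEntropy (ν₀ s) ((run G η τ α t).ν s))) hm
  have hV := run_V_succ G η τ α t s
  rw [hα] at hV
  rw [← hW] at h1 h2
  -- Each player's error is bounded by one involving both, so that both arguments of the maximum get
  -- the same bound.
  have p1 : 2 * (η * τ) * (2 / (1 - G.γ)) *
      (2 * relEntropy ((run G η τ α (t + 1)).μ s) ((run G η τ α (t + 1)).μbar s) +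
        relEntropy ((run G η τ α t).ν s) ((run G η τ α t).νbar s) +
        relEntropy ((run G η τ α (t + 1)).νbar s) ((run G η τ α t).ν s)) ≤
      2 * (η * τ) * (2 / (1 - G.γ)) * (2 * (run G η τ α (t + 1)).predDiv s +
        (run G η τ α t).predDiv s + (run G η τ α t).moveDiv (run G η τ α (t + 1)) s) := by
    refine mul_le_mul_of_nonneg_left ?_ hc
    simp only [predDiv, moveDiv]
    linarith
  have p2 : 2 * (η * τ) * (2 / (1 - G.γ)) *
      (2 * relEntropy ((run G η τ α (t + 1)).ν s) ((run G η τ α (t + 1)).νbar s) +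
        relEntropy ((run G η τ α t).μ s) ((run G η τ α t).μbar s) +
        relEntropy ((run G η τ α (t + 1)).μbar s) ((run G η τ α t).μ s)) ≤
      2 * (η * τ) * (2 / (1 - G.γ)) * (2 * (run G η τ α (t + 1)).predDiv s +
        (run G η τ α t).predDiv s + (run G η τ α t).moveDiv (run G η τ α (t + 1)) s) := by
    refine mul_le_mul_of_nonneg_left ?_ hc
    simp only [predDiv, moveDiv]
    linarith
  rw [vErr, vErr]
  refine max_le ?_ ?_
  · rw [hV]
    linarith
  · rw [hV]
    linarith

end Recursion

end Iterate

namespace Iterate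

open MarkovGame

variable {S A B : Type*} [Fintype S] [Fintype A] [Fintype B] [Nonempty A] [Nonempty B]

/-! ### Decay of the Lyapunov function -/

section Recursion

variable (G : MarkovGame S A B) {η τ : ℝ} {α : ℕ → ℝ} {W : S → ℝ} {μ₀ : Policy S A}
  {ν₀ : Policy S B} {ρ : stdSimplex ℝ S}

/-- The `Q` error at a state is attained at some action pair; these pairs form deterministic
policies, and one transition under them leads to the previous value error. -/
lemma qErr_succ_le (hτ : 0 ≤ τ) (t : ℕ) :
    G.reachSup ρ ((run G η τ α (t + 1)).qErr (G.qFun W)) ≤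
      G.γ * G.reachSup ρ ((run G η τ α t).vErr τ W μ₀ ν₀) := by
  choose x y hxy using fun s => exists_eq_matDist ((run G η τ α (t + 1)).Q s) (G.qFun W s)
  refine G.reachSup_next_le ρ G.γ_nonneg x y fun s => ?_
  rw [qErr, ← hxy, run_Q_succ]
  refine (G.abs_qFun_sub_le _ _ s _ _).trans (mul_le_mul_of_nonneg_left
    (Finset.sum_le_sum fun s' _ => mul_le_mul_of_nonneg_left ?_ (stdSimplex.zero_le _ s'))
    G.γ_nonneg)
  exact abs_sub_le_vErr _ τ W μ₀ ν₀ s' hτ (run_pos G η τ α t s').1 (run_pos G η τ α t s').2.1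

/-- The Lyapunov function. -/
def lyapunov (ρ : stdSimplex ℝ S) (η τ : ℝ) (W : S → ℝ) (μ₀ : Policy S A) (ν₀ : Policy S B)
    (z : Iterate S A B) : ℝ :=
  ∑ s, ρ s * z.eqDiv μ₀ ν₀ s + (∑ s, ρ s * z.predDiv s) / 2 +
    4 / ((1 - G.γ) * τ) * G.reachSup ρ (z.vErr τ W μ₀ ν₀) +
    η / 2 * G.reachSup ρ (z.qErr (G.qFun W))

lemma eqDiv_nonneg (t : ℕ) (s : S) : 0 ≤ (run G η τ α t).eqDiv μ₀ ν₀ s :=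
  add_nonneg (relEntropy_nonneg _ _ (run_pos G η τ α t s).1)
    (relEntropy_nonneg _ _ (run_pos G η τ α t s).2.1)

lemma predDiv_nonneg (t : ℕ) (s : S) : 0 ≤ (run G η τ α t).predDiv s :=
  add_nonneg (relEntropy_nonneg _ _ (run_pos G η τ α t s).2.2.1)
    (relEntropy_nonneg _ _ (run_pos G η τ α t s).2.2.2)

lemma moveDiv_nonneg (t : ℕ) (s : S) :
    0 ≤ (run G η τ α t).moveDiv (run G η τ α (t + 1)) s :=
  add_nonneg (relEntropy_nonneg _ _ (run_pos G η τ α t s).1)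
    (relEntropy_nonneg _ _ (run_pos G η τ α t s).2.1)

lemma barDiv_nonneg (hμ : ∀ s a, 0 < μ₀ s a) (hν : ∀ s b, 0 < ν₀ s b) (z : Iterate S A B)
    (s : S) : 0 ≤ z.barDiv μ₀ ν₀ s :=
  add_nonneg (relEntropy_nonneg _ _ (hμ s)) (relEntropy_nonneg _ _ (hν s))

lemma vErr_nonneg (hτ : 0 ≤ τ) (t : ℕ) (s : S) : 0 ≤ (run G η τ α t).vErr τ W μ₀ ν₀ s :=
  (abs_nonneg _).trans
    (abs_sub_le_vErr _ τ W μ₀ ν₀ s hτ (run_pos G η τ α t s).1 (run_pos G η τ α t s).2.1)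

/-- Divergences are averaged over `ρ`, value errors over the worst reachable distribution;
`lyapunov_step_le` balances them. The `barDiv` term is retained on the left because the stage gaps
need it. -/
lemma lyapunov_succ_le (hρ : ∀ s, 0 < ρ s) (hη : 0 < η) (hτ : 0 < τ) (hτ1 : τ ≤ 1)
    (hlog : τ * (Real.log (Fintype.card A) + Real.log (Fintype.card B)) ≤ 1)
    (hηC : 32000 * (η * G.concentrability ρ) ≤ (1 - G.γ) ^ 3)
    (hα : ∀ t, α (t + 1) = η * τ) (hητ : η * τ ≤ 1)
    (heq : ∀ s, IsEquilibrium τ (G.qFun W s) (μ₀ s) (ν₀ s))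
    (hW : ∀ s, W s = gameValue τ (G.qFun W s) (μ₀ s) (ν₀ s)) (t : ℕ) :
    lyapunov G ρ η τ W μ₀ ν₀ (run G η τ α (t + 1)) +
        η * τ * ∑ s, ρ s * (run G η τ α (t + 1)).barDiv μ₀ ν₀ s ≤
      (1 - (1 - G.γ) * (η * τ) / 4) * lyapunov G ρ η τ W μ₀ ν₀ (run G η τ α t) := by
  have hα0 : ∀ t, 0 ≤ α (t + 1) := fun t => by rw [hα]; positivity
  have hα1 : ∀ t, α (t + 1) ≤ 1 := fun t => by rwa [hα]
  have hγ := sub_pos.2 G.γ_lt_one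
  have hρ0 : ∀ s, 0 ≤ ρ s := fun s => (hρ s).le
  have hsum : ∀ f : S → ℝ, (∀ s, 0 ≤ f s) → 0 ≤ ∑ s, ρ s * f s := fun f hf =>
    Finset.sum_nonneg fun s _ => mul_nonneg (hρ0 s) (hf s)
  have hqn : ∀ t, 0 ≤ G.reachSup ρ ((run G η τ α t).qErr (G.qFun W)) := fun t =>
    G.reachSup_nonneg ρ fun s => matDist_nonneg _ _
  have hSsum : ∑ s, ρ s * (2 * (run G η τ α (t + 1)).predDiv s + (run G η τ α t).predDiv s +
      (run G η τ α t).moveDiv (run G η τ α (t + 1)) s) =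
      2 * ∑ s, ρ s * (run G η τ α (t + 1)).predDiv s + ∑ s, ρ s * (run G η τ α t).predDiv s +
      ∑ s, ρ s * (run G η τ α t).moveDiv (run G η τ α (t + 1)) s := by
    simp only [mul_add, Finset.sum_add_distrib, Finset.mul_sum]
    simp only [mul_left_comm]
  have h1 : ∑ s, ρ s * (1 * (run G η τ α (t + 1)).eqDiv μ₀ ν₀ s +
        1 * (run G η τ α (t + 1)).predDiv s +
        (1 - η * τ) * (run G η τ α t).moveDiv (run G η τ α (t + 1)) s +
        η * τ * (run G η τ α (t + 1)).barDiv μ₀ ν₀ s) ≤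
      ∑ s, ρ s * ((1 - η * τ) * (run G η τ α t).eqDiv μ₀ ν₀ s +
        (2 * η + 8 * η ^ 2 * (2 / (1 - G.γ))) * (run G η τ α (t + 1)).qErr (G.qFun W) s +
        8 * η ^ 2 * (2 / (1 - G.γ)) * (run G η τ α t).qErr (G.qFun W) s +
        2 * η * (2 / (1 - G.γ)) * (2 * (run G η τ α (t + 1)).predDiv s +
          (run G η τ α t).predDiv s + (run G η τ α t).moveDiv (run G η τ α (t + 1)) s)) := by
    refine Finset.sum_le_sum fun s _ => mul_le_mul_of_nonneg_left ?_ (hρ0 s)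
    have h := (isOptimisticStep_run G (η := η) hτ.le hlog hα0 hα1 heq t s).relEntropy_step_le
      hη.le hτ
    simp only [eqDiv, predDiv, moveDiv, barDiv]
    linarith
  rw [sum_mul_linear_comb, sum_mul_linear_comb, hSsum] at h1
  have hq1 := mul_le_mul_of_nonneg_left
    (G.sum_le_reachSup ρ ((run G η τ α (t + 1)).qErr (G.qFun W)))
    (by positivity : 0 ≤ 2 * η + 8 * η ^ 2 * (2 / (1 - G.γ)))
  have hq2 := mul_le_mul_of_nonneg_left
    (G.sum_le_reachSup ρ ((run G η τ α t).qErr (G.qFun W)))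
    (by positivity : 0 ≤ 8 * η ^ 2 * (2 / (1 - G.γ)))
  have h2 : G.reachSup ρ ((run G η τ α (t + 1)).vErr τ W μ₀ ν₀) ≤
      (1 - η * τ) * G.reachSup ρ ((run G η τ α t).vErr τ W μ₀ ν₀) +
      (η * τ + η * τ * (4 * η * (2 / (1 - G.γ)))) *
        G.reachSup ρ ((run G η τ α (t + 1)).qErr (G.qFun W)) +
      η * τ * (4 * η * (2 / (1 - G.γ))) * G.reachSup ρ ((run G η τ α t).qErr (G.qFun W)) +
      2 * (η * τ) * (2 / (1 - G.γ)) * (G.concentrability ρ *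
        (2 * ∑ s, ρ s * (run G η τ α (t + 1)).predDiv s + ∑ s, ρ s * (run G η τ α t).predDiv s +
        ∑ s, ρ s * (run G η τ α t).moveDiv (run G η τ α (t + 1)) s)) := by
    -- The error terms stay under `reachSup`; only the divergences are moved to `ρ`, at the price of
    -- the concentrability coefficient.
    refine G.reachSup_le ρ fun x y i => ?_
    refine (Finset.sum_le_sum fun s _ => mul_le_mul_of_nonneg_left
      (vErr_succ_le G hη hτ hlog hα hητ heq hW t s) (G.pushDist_nonneg ρ x y i s)).trans ?_
    rw [sum_mul_linear_comb, ← hSsum]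
    refine add_le_add (add_le_add (add_le_add
      (mul_le_mul_of_nonneg_left (G.le_reachSup ρ _ x y i) (by linarith))
      (mul_le_mul_of_nonneg_left (G.le_reachSup ρ _ x y i) (by positivity)))
      (mul_le_mul_of_nonneg_left (G.le_reachSup ρ _ x y i) (by positivity)))
      (mul_le_mul_of_nonneg_left (G.sum_pushDist_mul_le ρ hρ (fun s => ?_) x y i) (by positivity))
    have := predDiv_nonneg G (η := η) (τ := τ) (α := α) t s
    have := predDiv_nonneg G (η := η) (τ := τ) (α := α) (t + 1) s
    have := moveDiv_nonneg G (η := η) (τ := τ) (α := α) t s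
    linarith
  exact lyapunov_step_le hη hτ hτ1 hγ (by linarith [G.γ_nonneg]) (G.one_le_concentrability hρ)
    hηC (hsum _ (eqDiv_nonneg G t)) (hsum _ (predDiv_nonneg G t))
    (hsum _ (predDiv_nonneg G (t + 1))) (hsum _ (moveDiv_nonneg G t))
    (G.reachSup_nonneg ρ (vErr_nonneg G hτ.le t)) (hqn t)
    (by linarith) (by linarith) ((qErr_succ_le G hτ.le t).trans_eq (by rw [sub_sub_cancel]))

/-- In units of `1 / ((1 - γ) ^ 2 τ)`, the divergence to equilibrium contributes at most `1`, the
value potential `16` and the rest less than `1`; the constant `30` has slack. -/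
lemma lyapunov_zero_le (hη : 0 < η) (hη1 : η ≤ (1 - G.γ) / 32) (hτ : 0 < τ)
    (hτ1 : τ ≤ 1) (hlog : τ * (Real.log (Fintype.card A) + Real.log (Fintype.card B)) ≤ 1)
    (heq : ∀ s, IsEquilibrium τ (G.qFun W s) (μ₀ s) (ν₀ s)) (hWb : ∀ s, |W s| ≤ 2 / (1 - G.γ)) :
    lyapunov G ρ η τ W μ₀ ν₀ (run G η τ α 0) +
        η * τ * ∑ s, ρ s * (run G η τ α 0).barDiv μ₀ ν₀ s ≤ 30 / ((1 - G.γ) ^ 2 * τ) := by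
  have hγ := sub_pos.2 G.γ_lt_one
  have hγ1 : 1 - G.γ ≤ 1 := by linarith [G.γ_nonneg]
  have hmean : ∀ (f : S → ℝ) (c : ℝ), (∀ s, f s ≤ c) → ∑ s, ρ s * f s ≤ c := fun f c hf =>
    (G.sum_le_reachSup ρ f).trans (G.reachSup_le_of_le ρ hf)
  have hQ : ∀ s a b, |G.qFun W s a b| ≤ 2 / (1 - G.γ) := fun s a b => by
    have h1 := G.abs_qFun_le hWb s a b
    have h2 := G.one_add_mul_two_div
    linarith
  have hkμ : ∀ s, relEntropy (μ₀ s) ((run G η τ α 0).μ s) ≤ Real.log (Fintype.card A) :=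
    fun s => relEntropy_barycenter_le _
  have hkν : ∀ s, relEntropy (ν₀ s) ((run G η τ α 0).ν s) ≤ Real.log (Fintype.card B) :=
    fun s => relEntropy_barycenter_le _
  have hlA : 0 ≤ τ * Real.log (Fintype.card A) := mul_nonneg hτ.le (Real.log_natCast_nonneg _)
  have hlB : 0 ≤ τ * Real.log (Fintype.card B) := mul_nonneg hτ.le (Real.log_natCast_nonneg _)
  have hk : ∑ s, ρ s * (run G η τ α 0).eqDiv μ₀ ν₀ s ≤ 1 / τ := hmean _ _ fun s => by
    rw [le_div_iff₀ hτ, eqDiv]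
    nlinarith [hkμ s, hkν s]
  have ha : ∑ s, ρ s * (run G η τ α 0).predDiv s ≤ 0 := hmean _ _ fun s => by
    change relEntropy stdSimplex.barycenter stdSimplex.barycenter +
      relEntropy stdSimplex.barycenter stdSimplex.barycenter ≤ 0
    rw [relEntropy_self, relEntropy_self, add_zero]
  have hγ2 : 1 ≤ 1 / (1 - G.γ) := by rwa [le_div_iff₀ hγ, one_mul]
  have hu : G.reachSup ρ ((run G η τ α 0).vErr τ W μ₀ ν₀) ≤ 4 / (1 - G.γ) :=
    G.reachSup_le_of_le ρ fun s => by
      have h1 := abs_le.1 (run_abs_V_zero_le G η τ α hτ.le hlog s)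
      have h2 := abs_le.1 (hWb s)
      have h3 := mul_le_mul_of_nonneg_left (hkμ s) hτ.le
      have h4 := mul_le_mul_of_nonneg_left (hkν s) hτ.le
      have h5 : 4 / (1 - G.γ) = 2 / (1 - G.γ) + 2 * (1 / (1 - G.γ)) := by ring
      rw [vErr]
      refine max_le ?_ ?_
      · linarith [h1.1, h1.2, h2.1, h2.2]
      · linarith [h1.1, h1.2, h2.1, h2.2]
  have hq : G.reachSup ρ ((run G η τ α 0).qErr (G.qFun W)) ≤ 2 / (1 - G.γ) :=
    G.reachSup_le_of_le ρ fun s => ciSup_le fun ab => by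
      change |0 - G.qFun W s ab.1 ab.2| ≤ _
      rw [zero_sub, abs_neg]
      exact hQ s ab.1 ab.2
  have he : ∑ s, ρ s * (run G η τ α 0).barDiv μ₀ ν₀ s ≤ 8 / ((1 - G.γ) * τ) :=
    hmean _ _ fun s => by
      have h1 := relEntropy_barycenter_softResponse_le hτ (G.qFun W s) (hQ s) (ν₀ s)
      have h2 := relEntropy_barycenter_softResponse_le hτ (fun b a => -G.qFun W s a b)
        (fun b a => by
          rw [abs_neg]
          exact hQ s a b) (μ₀ s)
      rw [← (heq s).eq_softResponse hτ] at h1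
      rw [← (heq s).swap.eq_softResponse hτ] at h2
      have h3 : τ * (run G η τ α 0).barDiv μ₀ ν₀ s ≤ 8 / (1 - G.γ) := by
        change τ * (relEntropy stdSimplex.barycenter (μ₀ s) +
          relEntropy stdSimplex.barycenter (ν₀ s)) ≤ _
        rw [show 8 / (1 - G.γ) = 2 * (2 / (1 - G.γ)) + 2 * (2 / (1 - G.γ)) by ring]
        linarith
      rw [← div_div, le_div_iff₀ hτ]
      linarith
  have hu' := mul_le_mul_of_nonneg_left hu (by positivity : 0 ≤ 4 / ((1 - G.γ) * τ))
  have hq' := mul_le_mul_of_nonneg_left hq (by positivity : 0 ≤ η / 2)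
  have he' := mul_le_mul_of_nonneg_left he (by positivity : 0 ≤ η * τ)
  have hηg : η / (1 - G.γ) ≤ 1 / 32 := by
    rw [div_le_iff₀ hγ]
    linarith
  have hx : 1 ≤ 1 / ((1 - G.γ) ^ 2 * τ) := by
    rw [le_div_iff₀ (by positivity), one_mul]
    exact mul_le_one₀ (pow_le_one₀ hγ.le hγ1) hτ.le hτ1
  have hx' : 1 / τ ≤ 1 / ((1 - G.γ) ^ 2 * τ) :=
    one_div_le_one_div_of_le (by positivity)
      (mul_le_of_le_one_left hτ.le (pow_le_one₀ hγ.le hγ1))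
  have e1 : 4 / ((1 - G.γ) * τ) * (4 / (1 - G.γ)) = 16 * (1 / ((1 - G.γ) ^ 2 * τ)) := by
    field_simp
    norm_num
  have e2 : η / 2 * (2 / (1 - G.γ)) = η / (1 - G.γ) := by field_simp
  have e3 : η * τ * (8 / ((1 - G.γ) * τ)) = 8 * (η / (1 - G.γ)) := by field_simp
  have e4 : 30 / ((1 - G.γ) ^ 2 * τ) = 30 * (1 / ((1 - G.γ) ^ 2 * τ)) := by ring
  rw [e1] at hu'
  rw [e2] at hq'
  rw [e3] at he'
  rw [e4, lyapunov]
  linarith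

lemma reachSup_vErr_nonneg (hτ : 0 ≤ τ) (t : ℕ) :
    0 ≤ G.reachSup ρ ((run G η τ α t).vErr τ W μ₀ ν₀) :=
  G.reachSup_nonneg ρ (vErr_nonneg G hτ t)

/-- Linear convergence of the Lyapunov function. -/
lemma lyapunov_le (hρ : ∀ s, 0 < ρ s) (hη : 0 < η) (hτ : 0 < τ) (hτ1 : τ ≤ 1)
    (hlog : τ * (Real.log (Fintype.card A) + Real.log (Fintype.card B)) ≤ 1)
    (hηC : 32000 * (η * G.concentrability ρ) ≤ (1 - G.γ) ^ 3)
    (hα : ∀ t, α (t + 1) = η * τ)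
    (heq : ∀ s, IsEquilibrium τ (G.qFun W s) (μ₀ s) (ν₀ s))
    (hW : ∀ s, W s = gameValue τ (G.qFun W s) (μ₀ s) (ν₀ s)) (hWb : ∀ s, |W s| ≤ 2 / (1 - G.γ))
    (t : ℕ) :
    lyapunov G ρ η τ W μ₀ ν₀ (run G η τ α t) +
        η * τ * ∑ s, ρ s * (run G η τ α t).barDiv μ₀ ν₀ s ≤
      30 / ((1 - G.γ) ^ 2 * τ) * (1 - (1 - G.γ) * (η * τ) / 4) ^ t := by
  have hγ := sub_pos.2 G.γ_lt_one
  have hγ1 : 1 - G.γ ≤ 1 := by linarith [G.γ_nonneg]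
  have hηC' : η ≤ η * G.concentrability ρ :=
    le_mul_of_one_le_right hη.le (G.one_le_concentrability hρ)
  have hg3 : (1 - G.γ) ^ 3 ≤ 1 - G.γ := pow_le_of_le_one hγ.le hγ1 (by norm_num)
  have hητ : η * τ ≤ 1 := by linarith [mul_le_of_le_one_right hη.le hτ1]
  have hα0 : 0 < η * τ := mul_pos hη hτ
  have hr : 0 ≤ 1 - (1 - G.γ) * (η * τ) / 4 := by
    linarith [mul_le_of_le_one_left hα0.le hγ1]
  have hμ₀ : ∀ s a, 0 < μ₀ s a := fun s => (heq s).pos hτ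
  have hν₀ : ∀ s b, 0 < ν₀ s b := fun s => (heq s).swap.pos hτ
  induction t with
  | zero =>
    rw [pow_zero, mul_one]
    exact lyapunov_zero_le G hη (by linarith) hτ hτ1 hlog heq hWb
  | succ t ih =>
    refine (lyapunov_succ_le G hρ hη hτ hτ1 hlog hηC hα hητ heq hW t).trans ?_
    rw [pow_succ' (1 - (1 - G.γ) * (η * τ) / 4) t,
      mul_left_comm (30 / ((1 - G.γ) ^ 2 * τ))]
    refine mul_le_mul_of_nonneg_left (le_trans ?_ ih) hr
    -- The previous `barDiv` term is discarded: the recursion starts from the Lyapunov function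
    -- alone.
    have : 0 ≤ ∑ s, ρ s * (run G η τ α t).barDiv μ₀ ν₀ s :=
      Finset.sum_nonneg fun s _ => mul_nonneg (hρ s).le (barDiv_nonneg hμ₀ hν₀ _ s)
    linarith [mul_nonneg hα0.le this]

end Recursion

end Iterate

/-! ### Stage gaps in terms of relative entropies -/

section StageGap

variable {A B : Type*} [Fintype A] [Fintype B] [Nonempty A] [Nonempty B]

/-- The max player's stage gap against `qb`, in terms of an intermediate strategy `q`. -/
lemma IsEquilibrium.gameValue_sub_le {τ c : ℝ} (hτ : 0 < τ) {M : A → B → ℝ}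
    {p₀ : stdSimplex ℝ A} {q₀ : stdSimplex ℝ B} (h : IsEquilibrium τ M p₀ q₀) (hc : 0 ≤ c)
    (hM : ∀ a b, |M a b| ≤ c) (p : stdSimplex ℝ A) (q qb : stdSimplex ℝ B) (hq : ∀ b, 0 < q b)
    (hqb : ∀ b, 0 < qb b) :
    gameValue τ M p qb - gameValue τ M p₀ q₀ ≤ τ * relEntropy qb q₀ +
      16 * c ^ 2 / τ * (relEntropy q₀ q + relEntropy q qb) := by
  -- Two losses: `p₀` answers `q₀` rather than `qb`, a quadratic effect, and `qb` deviates from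
  -- `q₀`, an exact relative entropy.
  have h1 := gameValue_sub_softResponse_le hτ M hc hM p qb q₀
  rw [← h.eq_softResponse hτ] at h1
  have h2 := h.swap.sub_eq hτ qb
  rw [gameValue_swap, gameValue_swap] at h2
  have h3 := l1Dist_triangle q₀ q qb
  have h4 := sq_l1Dist_le q₀ q hq
  have h5 := sq_l1Dist_le q qb hqb
  have h6 : l1Dist q₀ qb ^ 2 ≤ 8 * (relEntropy q₀ q + relEntropy q qb) := by
    have h7 := pow_le_pow_left₀ (l1Dist_nonneg q₀ qb) h3 2
    nlinarith [sq_nonneg (l1Dist q₀ q - l1Dist q qb)]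
  have h8 := mul_le_mul_of_nonneg_left h6 (by positivity : 0 ≤ 2 * c ^ 2 / τ)
  have h9 : 2 * c ^ 2 / τ * (8 * (relEntropy q₀ q + relEntropy q qb)) =
      16 * c ^ 2 / τ * (relEntropy q₀ q + relEntropy q qb) := by ring
  linarith

end StageGap

end

/-! ### From the Lyapunov bound to the duality gap -/

theorem theorem4 {S A B : Type*} [Fintype S] [Fintype A] [Fintype B] [Nonempty A] [Nonempty B]
    (G : MarkovGame S A B) (ρ : stdSimplex ℝ S) (hρ : ∀ s, 0 < ρ s)
    (τ : ℝ) (hτ : 0 < τ)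
    (hτ' : τ ≤ 1 / max 1 (Real.log (Fintype.card A) + Real.log (Fintype.card B)))
    (η : ℝ) (hη : 0 < η) (hη' : η ≤ (1 - G.γ) ^ 3 / (32000 * G.concentrability ρ))
    (α : ℕ → ℝ) (hα : ∀ i, 1 ≤ i → α i = η * τ) (t : ℕ) :
    (∀ (s : S) (μ : Policy S A) (ν : Policy S B),
      G.value τ μ (Iterate.run G η τ α t).νbar s - G.value τ (Iterate.run G η τ α t).μbar ν s ≤
        6000 * ‖fun s' => 1 / ρ s'‖ / ((1 - G.γ) ^ 3 * τ)
          * max (8 / ((1 - G.γ) ^ 2 * τ)) (1 / η) * (1 - (1 - G.γ) * η * τ / 4) ^ t) ∧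
    (∀ (μ : Policy S A) (ν : Policy S B),
      G.valueAt τ μ (Iterate.run G η τ α t).νbar ρ
          - G.valueAt τ (Iterate.run G η τ α t).μbar ν ρ ≤
        6000 * G.mismatch τ ρ / ((1 - G.γ) ^ 3 * τ)
          * max (8 / ((1 - G.γ) ^ 2 * τ)) (1 / η) * (1 - (1 - G.γ) * η * τ / 4) ^ t) := by
  have hγ := sub_pos.2 G.γ_lt_one
  have hγ1 : 1 - G.γ ≤ 1 := by linarith [G.γ_nonneg]
  have hC := G.one_le_concentrability hρ
  have hm : (0 : ℝ) < max 1 (Real.log (Fintype.card A) + Real.log (Fintype.card B)) :=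
    lt_max_of_lt_left one_pos
  rw [le_div_iff₀ hm] at hτ'
  have hτ1 : τ ≤ 1 := by
    have := mul_le_mul_of_nonneg_left (le_max_left 1
      (Real.log (Fintype.card A) + Real.log (Fintype.card B))) hτ.le
    linarith
  have hlog : τ * (Real.log (Fintype.card A) + Real.log (Fintype.card B)) ≤ 1 :=
    (mul_le_mul_of_nonneg_left (le_max_right _ _) hτ.le).trans hτ'
  have hηC : 32000 * (η * G.concentrability ρ) ≤ (1 - G.γ) ^ 3 := by
    rw [le_div_iff₀ (by linarith)] at hη'
    linarith
  have hα' : ∀ t, α (t + 1) = η * τ := fun t => hα (t + 1) (Nat.le_add_left 1 t)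
  obtain ⟨W, μ₀, ν₀, heq, hW, hWb⟩ := G.exists_equilibrium hτ.le hlog
  have hQ : ∀ s a b, |G.qFun W s a b| ≤ 2 / (1 - G.γ) := fun s a b => by
    have h1 := G.abs_qFun_le hWb s a b
    have h2 := G.one_add_mul_two_div
    linarith
  have hL := Iterate.lyapunov_le G hρ hη hτ hτ1 hlog hηC hα' heq hW hWb t
  have hpos := Iterate.run_pos G η τ α t
  have hu := Iterate.reachSup_vErr_nonneg G (η := η) (τ := τ) (α := α) (W := W) (μ₀ := μ₀)
    (ν₀ := ν₀) (ρ := ρ) hτ.le t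
  have hq : 0 ≤ G.reachSup ρ ((Iterate.run G η τ α t).qErr (G.qFun W)) :=
    G.reachSup_nonneg ρ fun s => matDist_nonneg _ _
  have hkn : 0 ≤ ∑ s, ρ s * (Iterate.run G η τ α t).eqDiv μ₀ ν₀ s :=
    Finset.sum_nonneg fun s _ => mul_nonneg (hρ s).le (Iterate.eqDiv_nonneg G t s)
  have han : 0 ≤ ∑ s, ρ s * (Iterate.run G η τ α t).predDiv s :=
    Finset.sum_nonneg fun s _ => mul_nonneg (hρ s).le (Iterate.predDiv_nonneg G t s)
  have hen : 0 ≤ ∑ s, ρ s * (Iterate.run G η τ α t).barDiv μ₀ ν₀ s :=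
    Finset.sum_nonneg fun s _ => mul_nonneg (hρ s).le
      (Iterate.barDiv_nonneg (fun s => (heq s).pos hτ) (fun s => (heq s).swap.pos hτ) _ s)
  set z := Iterate.run G η τ α t with hz
  set D := max (8 / ((1 - G.γ) ^ 2 * τ)) (1 / η) with hD
  set r := (1 - (1 - G.γ) * η * τ / 4) ^ t with hr
  have hr' : (1 - (1 - G.γ) * (η * τ) / 4) ^ t = r := by rw [hr, mul_assoc (1 - G.γ)]
  rw [hr'] at hL
  let g₁ : S → ℝ := fun s => τ * relEntropy (z.νbar s) (ν₀ s) +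
    16 * (2 / (1 - G.γ)) ^ 2 / τ * (relEntropy (ν₀ s) (z.ν s) + relEntropy (z.ν s) (z.νbar s))
  let g₂ : S → ℝ := fun s => τ * relEntropy (z.μbar s) (μ₀ s) +
    16 * (2 / (1 - G.γ)) ^ 2 / τ * (relEntropy (μ₀ s) (z.μ s) + relEntropy (z.μ s) (z.μbar s))
  have hg₁ : ∀ s, 0 ≤ g₁ s := fun s =>
    add_nonneg (mul_nonneg hτ.le (relEntropy_nonneg _ _ ((heq s).swap.pos hτ)))
      (mul_nonneg (by positivity) (add_nonneg (relEntropy_nonneg _ _ (hpos s).2.1)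
        (relEntropy_nonneg _ _ (hpos s).2.2.2)))
  have hg₂ : ∀ s, 0 ≤ g₂ s := fun s =>
    add_nonneg (mul_nonneg hτ.le (relEntropy_nonneg _ _ ((heq s).pos hτ)))
      (mul_nonneg (by positivity) (add_nonneg (relEntropy_nonneg _ _ (hpos s).1)
        (relEntropy_nonneg _ _ (hpos s).2.2.1)))
  have h₁ : ∀ (μ : Policy S A) s, gameValue τ (G.qFun W s) (μ s) (z.νbar s) - W s ≤ g₁ s :=
    fun μ s => by
      have := (heq s).gameValue_sub_le hτ (by positivity) (hQ s) (μ s) (z.ν s) (z.νbar s)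
        (hpos s).2.1 (hpos s).2.2.2
      rwa [← hW] at this
  have h₂ : ∀ (ν : Policy S B) s, W s - gameValue τ (G.qFun W s) (z.μbar s) (ν s) ≤ g₂ s :=
    fun ν s => by
      have := (heq s).swap.gameValue_sub_le (c := 2 / (1 - G.γ)) hτ (by positivity) (fun b a => by
        rw [abs_neg]
        exact hQ s a b) (ν s) (z.μ s) (z.μbar s) (hpos s).1 (hpos s).2.2.1
      rw [gameValue_swap, gameValue_swap, ← hW] at this
      linarith
  have hsum : ∑ s, ρ s * (g₁ s + g₂ s) ≤ 480 / ((1 - G.γ) ^ 2 * τ) * D * r := by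
    have e1 : ∑ s, ρ s * (g₁ s + g₂ s) = 1 / η * (η * τ * ∑ s, ρ s * z.barDiv μ₀ ν₀ s) +
        8 / ((1 - G.γ) ^ 2 * τ) * (8 * (∑ s, ρ s * z.eqDiv μ₀ ν₀ s + ∑ s, ρ s * z.predDiv s)) := by
      rw [← Finset.sum_add_distrib]
      simp only [Finset.mul_sum]
      rw [← Finset.sum_add_distrib]
      refine Finset.sum_congr rfl fun s _ => ?_
      simp only [g₁, g₂, Iterate.barDiv, Iterate.eqDiv, Iterate.predDiv]
      field_simp
      ring
    have hD1 : 8 / ((1 - G.γ) ^ 2 * τ) ≤ D := le_max_left _ _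
    have hD2 : 1 / η ≤ D := le_max_right _ _
    have hD0 : 0 ≤ D := le_trans (by positivity) hD2
    have i1 := mul_le_mul_of_nonneg_right hD2 (mul_nonneg (mul_pos hη hτ).le hen)
    have i2 := mul_le_mul_of_nonneg_right hD1
      (mul_nonneg (by norm_num : (0 : ℝ) ≤ 8) (add_nonneg hkn han))
    have i3 := mul_le_mul_of_nonneg_left hL (mul_nonneg (by norm_num : (0 : ℝ) ≤ 16) hD0)
    have hK : 0 ≤ 4 / ((1 - G.γ) * τ) * G.reachSup ρ (z.vErr τ W μ₀ ν₀) :=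
      mul_nonneg (by positivity) hu
    have hM : 0 ≤ η / 2 * G.reachSup ρ (z.qErr (G.qFun W)) := mul_nonneg (by positivity) hq
    -- The factor `16` is forced by the weight `1/2` of the prediction divergence in the Lyapunov
    -- function.
    have i4 : η * τ * ∑ s, ρ s * z.barDiv μ₀ ν₀ s +
        8 * (∑ s, ρ s * z.eqDiv μ₀ ν₀ s + ∑ s, ρ s * z.predDiv s) ≤
        16 * (Iterate.lyapunov G ρ η τ W μ₀ ν₀ z + η * τ * ∑ s, ρ s * z.barDiv μ₀ ν₀ s) := by
      have := mul_nonneg (mul_pos hη hτ).le hen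
      rw [Iterate.lyapunov]
      linarith
    have i5 := mul_le_mul_of_nonneg_left i4 hD0
    rw [e1]
    calc _ ≤ D * (16 * (Iterate.lyapunov G ρ η τ W μ₀ ν₀ z +
          η * τ * ∑ s, ρ s * z.barDiv μ₀ ν₀ s)) := by linarith
      _ ≤ 16 * D * (30 / ((1 - G.γ) ^ 2 * τ) * r) := by linarith
      _ = 480 / ((1 - G.γ) ^ 2 * τ) * D * r := by ring
  have hsum0 : 0 ≤ ∑ s, ρ s * (g₁ s + g₂ s) :=
    Finset.sum_nonneg fun s _ => mul_nonneg (hρ s).le (add_nonneg (hg₁ s) (hg₂ s))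
  have hfin : ∀ X c : ℝ, 0 ≤ c → (1 - G.γ) * X ≤ c * ∑ s, ρ s * (g₁ s + g₂ s) →
      X ≤ 6000 * c / ((1 - G.γ) ^ 3 * τ) * D * r := fun X c hc hX => by
    -- The argument yields `480 = 16 * 30`; the stated constant is larger by `25/2`.
    have j1 : 480 / ((1 - G.γ) ^ 2 * τ) * D * r ≤ 6000 / ((1 - G.γ) ^ 2 * τ) * D * r := by
      have j2 : 0 ≤ 480 / ((1 - G.γ) ^ 2 * τ) * D * r := hsum0.trans hsum
      have j3 : 6000 / ((1 - G.γ) ^ 2 * τ) * D * r =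
          25 / 2 * (480 / ((1 - G.γ) ^ 2 * τ) * D * r) := by ring
      linarith
    have j4 := hX.trans (mul_le_mul_of_nonneg_left (hsum.trans j1) hc)
    rw [← le_div_iff₀' hγ] at j4
    refine j4.trans (le_of_eq ?_)
    field_simp
  -- Best responses exist and have nonnegative visitation, so the coefficient is nonnegative.
  have hmis : 0 ≤ G.mismatch τ ρ := by
    obtain ⟨μ', hμ'⟩ := G.exists_isMaxResponse ρ hτ z.νbar
    obtain ⟨s, -⟩ := exists_pos ρ
    have h := G.visitation_le_of_isMaxResponse hρ hμ' s
    exact nonneg_of_mul_nonneg_left ((G.visitation_nonneg ρ _ _ s).trans h) (hρ s)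
  exact ⟨fun s μ ν => hfin _ _ (norm_nonneg _)
      (G.value_gap_le hρ W z.μbar μ z.νbar ν hg₁ hg₂ h₁ h₂ s),
    fun μ ν => hfin _ _ hmis (G.valueAt_gap_le hρ hτ W z.μbar μ z.νbar ν hg₁ hg₂ h₁ h₂)⟩
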